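/- Let $\mathcal{M}_d$ be the complex $d\times d$ matrices and $T:\mathcal{M}_{d_{A'}}\to\mathcal{M}_{d_{B'}}$ a quantum channel (a completely positive, trace-preserving linear map). States are positive semidefinite matrices of trace one, and a state is separable for a bipartition if it is a finite convex combination of product states. *Max-relative entropy of entanglement.* For states put $D_{\max}(\rho\|\sigma)=\inf\{\lambda\ge 0:\rho\le 2^{\lambda}\sigma\}$ (with $\inf\emptyset=+\infty$), let $E^{A:B}_{\max}(\rho_{AB})$ be the infimum of $D_{\max}(\rho_{AB}\|\sigma_{AB})$ over all states $\sigma_{AB}$ that are separable for $A:B$, and let $$E_{\max}(T)=\sup\{E^{A:B'}_{\max}((\mathrm{id}_A\otimes T)(\rho_{AA'})) : d_A\in\mathbb{N},\ \rho_{AA'}\text{ a state on }\mathbb{C}^{d_A}\otimes\mathbb{C}^{d_{A'}}\}.$$ *Coding schemes.* An LOCC-operation is a finite composition of local channels and of rounds in which $A$ and $B$ apply local operations with Kraus operators $(K^A_i)_i$, $(K^B_j)_j$ ($\sum_i (K^A_i)^\dagger K^A_i=\mathbb{1}$, $\sum_j (K^B_j)^\dagger K^B_j=\mathbb{1}$)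 and send each other the outcomes $i$ and $j$. A coding scheme with $m\ge 1$ uses of $T$ consists of a state $\rho_{A_1A'B_1}$ that is separable for $A_1A':B_1$ and LOCC-operations $L_1,\dots,L_m$, where $L_i$ ($i<m$) maps $A_i:B'B_i$ to $A_{i+1}A':B_{i+1}$ and $L_m$ maps $A_m:B'B_m$ to $\tilde A:\tilde B$, all dimensions of $A_i,B_i,\tilde A,\tilde B$ being arbitrary. Its output state $\phi_{\tilde A\tilde B}$ is obtained from $\rho_{A_1A'B_1}$ by applying, in this order, $T$ (from $A'$ to $B'$), $L_1$, $T$, $L_2$, …, $T$, $L_m$. *Private states.* A private state with $K$-dimensional key part is a state on $A_kB_kA_sB_s$, with $d_{A_k}=d_{B_k}=K$ and $d_{A_s}=d_{B_s}$, of the form $U(\omega_{A_kB_k}\otimes\sigma_{A_sB_s})U^\dagger$, where $\omega$ is the maximally entangled state $\frac1K\sum_{i,j}|ii\rangle\langle jj|$, $\sigma$ is any state, and $U=\sum_{i,j}|i\rangle\langle i|\otimes|j\rangle\langle j|\otimes U^{ij}$ with unitaries $U^{ij}$ on $A_sB_s$. A $(k,m,\varepsilon)$-coding scheme for private state generation ($k\in\mathbb{N}$)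 is a coding scheme with $m$ uses of $T$, $\tilde A=A_kA_s$, $\tilde B=B_kB_s$, $d_{A_k}=d_{B_k}=2^k$, $d_{A_s}=d_{B_s}$, such that $\varepsilon=\frac12\|\phi_{\tilde A\tilde B}-\gamma\|_1$ for some private state $\gamma$ with $2^k$-dimensional key part. *Private capacity.* $\mathcal{P}_\leftrightarrow(T)$ is the supremum of all $R\ge 0$ for which there are $(k_\nu,m_\nu,\varepsilon_\nu)$-coding schemes for private state generation ($\nu\in\mathbb{N}$) with $m_\nu\to\infty$, $k_\nu/m_\nu\to R$ and $\varepsilon_\nu\to 0$. **Theorem.** For every quantum channel $T:\mathcal{M}_{d_{A'}}\to\mathcal{M}_{d_{B'}}$ the quantity $E_{\max}(T)$ is a strong-converse bound on $\mathcal{P}_\leftrightarrow(T)$. That is, $E_{\max}(T)<\infty$, $\mathcal{P}_\leftrightarrow(T)\le E_{\max}(T)$, and for every sequence of $(k_\nu,m_\nu,\varepsilon_\nu)$-coding schemes for private state generation over $T$ with $m_\nu\to\infty$ and $R=\lim_{\nu\to\infty}k_\nu/m_\nu>E_{\max}(T)$ one has $\varepsilon_\nu\to 1$ as $\nu\to\infty$.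 -/

import Mathlib

open Filter Topology
open scoped NNReal ENNReal Kronecker ComplexOrder

noncomputable section

namespace PrivateCapacity

/-- Density matrices: positive semidefinite matrices of trace one. -/
structure IsState {n : Type*} [Fintype n] (ρ : Matrix n n ℂ) : Prop where
  posSemidef : ρ.PosSemidef
  trace_eq_one : ρ.trace = 1

/-- The partial application `id ⊗ T` of a linear map to the second tensor factor. -/
def applySnd {r a b : Type*} (T : Matrix a a ℂ →ₗ[ℂ] Matrix b b ℂ)
    (X : Matrix (r × a) (r × a) ℂ) : Matrix (r × b) (r × b) ℂ :=
  Matrix.of fun x y => T (Matrix.of fun s t => X (x.1, s) (y.1, t)) x.2 y.2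

/-- The partial application of `T` (from `A'` to `B'`) to the middle factor of a matrix on
`A ⊗ A' ⊗ B`. The input is read in the bipartition `A A' : B`, the output in `A : B' B`. -/
def applyMid {A a b B : Type*} (T : Matrix a a ℂ →ₗ[ℂ] Matrix b b ℂ)
    (X : Matrix ((A × a) × B) ((A × a) × B) ℂ) : Matrix (A × (b × B)) (A × (b × B)) ℂ :=
  Matrix.of fun x y =>
    T (Matrix.of fun s t => X ((x.1, s), x.2.2) ((y.1, t), y.2.2)) x.2.1 y.2.1

/-- Quantum channels: completely positive and trace-preserving linear maps between matrix
algebras. -/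
structure IsChannel {a b : Type*} [Fintype a] [Fintype b]
    (T : Matrix a a ℂ →ₗ[ℂ] Matrix b b ℂ) : Prop where
  completelyPositive : ∀ (r : ℕ) (X : Matrix (Fin r × a) (Fin r × a) ℂ),
    X.PosSemidef → (applySnd T X).PosSemidef
  tracePreserving : ∀ X : Matrix a a ℂ, (T X).trace = X.trace

/-- States that are separable with respect to the bipartition `A : B`: finite convex combinations
of product states. -/
def IsSeparable {A B : Type*} [Fintype A] [Fintype B] (ρ : Matrix (A × B) (A × B) ℂ) : Prop :=
  ρ ∈ convexHull ℝ {τ : Matrix (A × B) (A × B) ℂ |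
    ∃ (α : Matrix A A ℂ) (β : Matrix B B ℂ), IsState α ∧ IsState β ∧ τ = α ⊗ₖ β}

/-- The max-relative entropy (base two): the infimum of all `l ≥ 0` with `ρ ≤ 2 ^ l σ` in the
Loewner order, which is `∞` if there is none. -/
def dMax {n : Type*} (ρ σ : Matrix n n ℂ) : ℝ≥0∞ :=
  ⨅ (l : ℝ≥0) (_ : ((2 : ℝ) ^ (l : ℝ) • σ - ρ).PosSemidef), (l : ℝ≥0∞)

/-- The max-relative entropy of entanglement of a bipartite state. -/
def eMaxState {A B : Type*} [Fintype A] [Fintype B] (ρ : Matrix (A × B) (A × B) ℂ) : ℝ≥0∞ :=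
  ⨅ (σ : Matrix (A × B) (A × B) ℂ) (_ : IsSeparable σ), dMax ρ σ

/-- The max-relative entropy of entanglement of a channel `T` with input system `a`: the supremum
over all dimensions `d` and all states `ρ` on `ℂ^d ⊗ ℂ^a`. -/
def eMax {a b : Type*} [Fintype a] [Fintype b] (T : Matrix a a ℂ →ₗ[ℂ] Matrix b b ℂ) : ℝ≥0∞ :=
  ⨆ (d : ℕ) (ρ : Matrix (Fin d × a) (Fin d × a) ℂ) (_ : IsState ρ), eMaxState (applySnd T ρ)

section LOCC

variable {A B A' B' I J : Type} [Fintype A] [Fintype B] [Fintype I] [Fintype J]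

/-- One round of local operations and classical communication: both parties apply a local
operation with Kraus operators `KA i` and `KB j`; the outcome `j` is written into a classical
register of `A` and the outcome `i` into a classical register of `B`. -/
def loccRound [DecidableEq I] [DecidableEq J]
    (KA : I → Matrix A' A ℂ) (KB : J → Matrix B' B ℂ) :
    Matrix (A × B) (A × B) ℂ →ₗ[ℂ] Matrix ((A' × J) × (B' × I)) ((A' × J) × (B' × I)) ℂ where
  toFun X := ∑ i, ∑ j,
    (((KA i ⊗ₖ KB j) * X * (KA i ⊗ₖ KB j).conjTranspose) ⊗ₖ
      (Matrix.single j j (1 : ℂ) ⊗ₖ Matrix.single i i (1 : ℂ))).submatrix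
        (Equiv.prodProdProdComm A' J B' I) (Equiv.prodProdProdComm A' J B' I)
  map_add' X Y := by
    simp only [Matrix.mul_add, Matrix.add_mul, Matrix.add_kronecker, Matrix.submatrix_add,
      Pi.add_apply, Finset.sum_add_distrib]
  map_smul' c X := by
    simp only [Matrix.mul_smul, Matrix.smul_mul, Matrix.smul_kronecker, Matrix.submatrix_smul,
      Pi.smul_apply, Finset.smul_sum, RingHom.id_apply]

/-- The product of the two local channels with Kraus operators `KA i` and `KB j`, no outcome being
kept. -/
def localChannels (KA : I → Matrix A' A ℂ) (KB : J → Matrix B' B ℂ) :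
    Matrix (A × B) (A × B) ℂ →ₗ[ℂ] Matrix (A' × B') (A' × B') ℂ where
  toFun X := ∑ i, ∑ j, (KA i ⊗ₖ KB j) * X * (KA i ⊗ₖ KB j).conjTranspose
  map_add' X Y := by
    simp only [Matrix.mul_add, Matrix.add_mul, Finset.sum_add_distrib]
  map_smul' c X := by
    simp only [Matrix.mul_smul, Matrix.smul_mul, Finset.smul_sum, RingHom.id_apply]

end LOCC

/-- LOCC-operations, from the bipartition `A : B` to the bipartition `A' : B'`: finite compositions
of rounds of local operations with communication of the outcomes, and of local channels without
communication (discarding classical registers, renaming bases, doing nothing). -/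
inductive IsLOCC : {A B A' B' : Type} →
    (Matrix (A × B) (A × B) ℂ →ₗ[ℂ] Matrix (A' × B') (A' × B') ℂ) → Prop
  | round {A B A' B' I J : Type} [Fintype A] [Fintype B] [Fintype A'] [Fintype B']
      [Fintype I] [Fintype J] [DecidableEq A] [DecidableEq B] [DecidableEq I] [DecidableEq J]
      (KA : I → Matrix A' A ℂ) (KB : J → Matrix B' B ℂ)
      (hA : ∑ i, (KA i).conjTranspose * KA i = 1) (hB : ∑ j, (KB j).conjTranspose * KB j = 1) :
      IsLOCC (loccRound KA KB)
  | loc {A B A' B' I J : Type} [Fintype A] [Fintype B] [Fintype A'] [Fintype B']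
      [Fintype I] [Fintype J] [DecidableEq A] [DecidableEq B]
      (KA : I → Matrix A' A ℂ) (KB : J → Matrix B' B ℂ)
      (hA : ∑ i, (KA i).conjTranspose * KA i = 1) (hB : ∑ j, (KB j).conjTranspose * KB j = 1) :
      IsLOCC (localChannels KA KB)
  | comp {A B C D A' B' : Type}
      {L : Matrix (A × B) (A × B) ℂ →ₗ[ℂ] Matrix (C × D) (C × D) ℂ}
      {M : Matrix (C × D) (C × D) ℂ →ₗ[ℂ] Matrix (A' × B') (A' × B') ℂ}
      (hM : IsLOCC M) (hL : IsLOCC L) : IsLOCC (M ∘ₗ L)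

section Coding

variable {a b : ℕ} (T : Matrix (Fin a) (Fin a) ℂ →ₗ[ℂ] Matrix (Fin b) (Fin b) ℂ)

/-- `IsAssistedState T m σ`: `σ` is the state on `A_m : B' B_m` held directly after the `m`-th use
of `T` in some coding scheme assisted by classical communication. The scheme starts from a state
that is separable for `A_1 A' : B_1` and uses LOCC-operations between the uses of `T`; the dimensions
of the systems `A_i`, `B_i` are arbitrary. -/
inductive IsAssistedState : ℕ → {p q : ℕ} →
    Matrix (Fin p × (Fin b × Fin q)) (Fin p × (Fin b × Fin q)) ℂ → Prop
  | first {p q : ℕ} (ρ : Matrix ((Fin p × Fin a) × Fin q) ((Fin p × Fin a) × Fin q) ℂ)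
      (hρ : IsSeparable ρ) : IsAssistedState 1 (applyMid T ρ)
  | next {m p q p' q' : ℕ} (σ : Matrix (Fin p × (Fin b × Fin q)) (Fin p × (Fin b × Fin q)) ℂ)
      (hσ : IsAssistedState m σ)
      (L : Matrix (Fin p × (Fin b × Fin q)) (Fin p × (Fin b × Fin q)) ℂ →ₗ[ℂ]
        Matrix ((Fin p' × Fin a) × Fin q') ((Fin p' × Fin a) × Fin q') ℂ)
      (hL : IsLOCC L) : IsAssistedState (m + 1) (applyMid T (L σ))

/-- `φ` is the output state of a coding scheme assisted by classical communication with `m` uses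
of `T`: a final LOCC-operation is applied after the last use. -/
def IsCodingOutput (m : ℕ) {A B : Type} (φ : Matrix (A × B) (A × B) ℂ) : Prop :=
  ∃ (p q : ℕ) (σ : Matrix (Fin p × (Fin b × Fin q)) (Fin p × (Fin b × Fin q)) ℂ)
    (L : Matrix (Fin p × (Fin b × Fin q)) (Fin p × (Fin b × Fin q)) ℂ →ₗ[ℂ]
      Matrix (A × B) (A × B) ℂ),
    IsAssistedState T m σ ∧ IsLOCC L ∧ φ = L σ

/-- The maximally entangled state on `ℂ^K ⊗ ℂ^K`. -/
def maxEntangled (K : ℕ) : Matrix (Fin K × Fin K) (Fin K × Fin K) ℂ :=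
  Matrix.of fun x y => if x.1 = x.2 ∧ y.1 = y.2 then (1 / K : ℂ) else 0

/-- The twisting unitary `∑ i j, |i⟩⟨i| ⊗ |j⟩⟨j| ⊗ U i j`. -/
def twisting {K s : ℕ} (U : Fin K → Fin K → Matrix (Fin s × Fin s) (Fin s × Fin s) ℂ) :
    Matrix ((Fin K × Fin K) × (Fin s × Fin s)) ((Fin K × Fin K) × (Fin s × Fin s)) ℂ :=
  ∑ i, ∑ j, (Matrix.single i i (1 : ℂ) ⊗ₖ Matrix.single j j (1 : ℂ)) ⊗ₖ U i j

/-- Private states with `K`-dimensional key part and shield systems of dimension `s`, written in the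
bipartition `A_k A_s : B_k B_s`. -/
def IsPrivateState {K s : ℕ}
    (γ : Matrix ((Fin K × Fin s) × (Fin K × Fin s)) ((Fin K × Fin s) × (Fin K × Fin s)) ℂ) :
    Prop :=
  ∃ (σ : Matrix (Fin s × Fin s) (Fin s × Fin s) ℂ)
    (U : Fin K → Fin K → Matrix (Fin s × Fin s) (Fin s × Fin s) ℂ),
    IsState σ ∧ (∀ i j, U i j ∈ Matrix.unitaryGroup (Fin s × Fin s) ℂ) ∧
    γ = (twisting U * (maxEntangled K ⊗ₖ σ) * (twisting U).conjTranspose).submatrix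
      (Equiv.prodProdProdComm (Fin K) (Fin s) (Fin K) (Fin s))
      (Equiv.prodProdProdComm (Fin K) (Fin s) (Fin K) (Fin s))

/-- The trace norm: the sum of the singular values. -/
def traceNorm {n : Type*} [Fintype n] [DecidableEq n] (X : Matrix n n ℂ) : ℝ :=
  ∑ i, Real.sqrt ((Matrix.isHermitian_conjTranspose_mul_self X).eigenvalues i)

/-- There is a `(k, m, ε)`-coding scheme for private state generation over `T` assisted by classical
communication. -/
def HasPrivateScheme (k m : ℕ) (ε : ℝ) : Prop :=
  ∃ (s : ℕ) (φ γ : Matrix ((Fin (2 ^ k) × Fin s) × (Fin (2 ^ k) × Fin s))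
      ((Fin (2 ^ k) × Fin s) × (Fin (2 ^ k) × Fin s)) ℂ),
    IsCodingOutput T m φ ∧ IsPrivateState γ ∧ ε = 1 / 2 * traceNorm (φ - γ)

/-- The sequences `(k ν, m ν, ε ν)` of parameters of coding schemes for private state generation,
with unboundedly growing number of channel uses, that have rate `R`. -/
structure IsSchemeSequence (R : ℝ≥0) (k m : ℕ → ℕ) (ε : ℕ → ℝ) : Prop where
  scheme : ∀ ν, HasPrivateScheme T (k ν) (m ν) (ε ν)
  uses : Tendsto m atTop atTop
  rate : Tendsto (fun ν => (k ν : ℝ) / (m ν : ℝ)) atTop (𝓝 (R : ℝ))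

/-- Achievable rates for private communication assisted by classical communication. -/
def IsAchievable (R : ℝ≥0) : Prop :=
  ∃ (k m : ℕ → ℕ) (ε : ℕ → ℝ), IsSchemeSequence T R k m ε ∧ Tendsto ε atTop (𝓝 0)

/-- The private capacity of `T` assisted by two-way classical communication. -/
def privateCapacity : ℝ≥0∞ :=
  ⨆ (R : ℝ≥0) (_ : IsAchievable T R), (R : ℝ≥0∞)

/-- `B` is a strong-converse bound on the private capacity of `T` assisted by two-way classical
communication: it is a finite upper bound, and the error of all schemes of a rate above `B` tends
to one. -/
structure IsStrongConverseBound (B : ℝ≥0∞) : Prop where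
  finite : B < ∞
  upperBound : privateCapacity T ≤ B
  strongConverse : ∀ (R : ℝ≥0) (k m : ℕ → ℕ) (ε : ℕ → ℝ),
    IsSchemeSequence T R k m ε → B < (R : ℝ≥0∞) → Tendsto ε atTop (𝓝 1)

end Coding

end PrivateCapacity

end

/-!
The max-relative entropy of entanglement grows by at most `eMax T` per use of `T`, even if the
inputs of `T` are already entangled with the receiver, and it does not grow under LOCC. So the
output of a scheme with `m` uses is dominated by a separable matrix of trace about
`2 ^ (m * eMax T)`, and separable matrices hardly pass the test for a private state with a key of
dimension `2 ^ k`.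

*Growth per use.* For `l > eMax T` and `c > 2 ^ l` there is a separable matrix `S` which dominates
the Choi matrix of `T` and whose partial trace over the output is at most `c • 1`
(`exists_isEntBreakingBound_of_eMax_lt`). For a fixed full-rank input `τ`, evaluating `eMax T` on a
purification of `τ` gives a separable bound that is good on `τ`
(`exists_separable_bound_of_posDef`); a Hahn-Banach separation exchanges the quantifiers. The map
with Choi matrix `S` is entanglement breaking, so it takes a separable `σ` for `A A' : B` to a
separable matrix for `A : B' B`, with trace at most `c` times larger. From `ρ ≤ σ` follows
`T(ρ) ≤ T(σ) ≤ S(σ)` (`IsEntBreakingBound.isDominated_applyMid`), and by induction the output of a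
scheme is dominated by a separable matrix of trace at most `c ^ m`
(`IsCodingOutput.isState_and_isDominated`). The multiple `tr J • 1` of the identity, `J` being the
Choi matrix of `T`, is always a possible `S`, whence `eMax T < ∞`.

*The test.* A private state with `K`-dimensional key part is supported on the range of the isometry
`K ^ (-1/2) ∑ i, |i i⟩ ⊗ U i i`, while a separable matrix has at most the fraction `1 / K` of its
trace there, by the Cauchy-Schwarz inequality (`trace_keyBlock_re_le`). Hence the trace distance to
a private state lies between `1 - c ^ m / 2 ^ k` and one (`IsPrivateState.le_half_traceNorm`), which
tends to one at rates above `log₂ c`. The bound on the capacity is a consequence, since errors that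
tend to one do not tend to zero.
-/

namespace PrivateCapacity

open Matrix

/-! ### Positive semidefinite matrices -/

section PosSemidef

variable {n a : Type*}

open scoped MatrixOrder in
lemma exists_eq_conjTranspose_mul_self [Fintype n] {M : Matrix n n ℂ} (hM : M.PosSemidef) :
    ∃ B : Matrix n n ℂ, M = Bᴴ * B := by
  classical
  obtain ⟨B, hB⟩ := CStarAlgebra.nonneg_iff_eq_star_mul_self.mp hM.nonneg
  exact ⟨B, hB⟩

lemma posSemidef_sum_blocks [Fintype n] [Fintype a] {Y : Matrix (n × a) (n × a) ℂ}
    (hY : Y.PosSemidef) :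
    (of fun x y => ∑ s, ∑ t, Y (x, s) (y, t) : Matrix n n ℂ).PosSemidef := by
  classical
  convert hY.conjTranspose_mul_mul_same
    (of fun (x : n × a) (y : n) => if x.1 = y then (1 : ℂ) else 0) using 1
  ext x y
  have key : ∀ (z : n) (g : n → a → ℂ),
      ∑ p, ∑ q, (if p = z then g p q else 0) = ∑ q, g z q := by
    intro z g
    rw [Finset.sum_comm]
    simp
  simp only [of_apply, mul_apply, conjTranspose_apply, Fintype.sum_prod_type, mul_ite, mul_one,
    mul_zero, key, apply_ite star, star_one, star_zero, ite_mul, one_mul, zero_mul]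
  exact Finset.sum_comm

lemma posSemidef_iff_re [Fintype n] {M : Matrix n n ℂ} (hM : M.IsHermitian) :
    M.PosSemidef ↔ ∀ v : n → ℂ, 0 ≤ (star v ⬝ᵥ (M *ᵥ v)).re := by
  refine ⟨fun h v => h.re_dotProduct_nonneg v, fun h =>
    .of_dotProduct_mulVec_nonneg hM fun v => ?_⟩
  rw [Complex.nonneg_iff]
  exact ⟨h v, (hM.im_star_dotProduct_mulVec_self v).symm⟩

lemma _root_.Matrix.PosSemidef.trace_re_nonneg [Fintype n] {M : Matrix n n ℂ} (hM : M.PosSemidef) :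
    0 ≤ M.trace.re :=
  (Complex.nonneg_iff.mp hM.trace_nonneg).1

lemma _root_.Matrix.PosSemidef.trace_eq_ofReal [Fintype n] {M : Matrix n n ℂ} (hM : M.PosSemidef) :
    M.trace = (M.trace.re : ℂ) :=
  Complex.ext rfl (Complex.nonneg_iff.mp hM.trace_nonneg).2.symm

/-- A positive semidefinite matrix is bounded by its trace. -/
lemma posSemidef_trace_smul_one_sub [Fintype n] [DecidableEq n] {M : Matrix n n ℂ}
    (hM : M.PosSemidef) : (M.trace.re • (1 : Matrix n n ℂ) - M).PosSemidef := by
  have hH : (M.trace.re • (1 : Matrix n n ℂ) - M).IsHermitian := by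
    refine IsHermitian.sub ?_ hM.isHermitian
    simp [IsHermitian, conjTranspose_smul]
  obtain ⟨B, hB⟩ := exists_eq_conjTranspose_mul_self hM
  have htr : M.trace.re = ∑ i, ∑ j, ‖B i j‖ ^ 2 := by
    rw [hB, trace, Finset.sum_comm]
    simp [mul_apply, ← Complex.normSq_eq_norm_sq, Complex.normSq_apply]
  rw [posSemidef_iff_re hH]
  intro v
  have h1 : (star v ⬝ᵥ ((M.trace.re • (1 : Matrix n n ℂ)) *ᵥ v)).re
      = M.trace.re * ∑ j, ‖v j‖ ^ 2 := by
    simp only [smul_mulVec, one_mulVec, dotProduct_smul, Complex.smul_re, smul_eq_mul]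
    simp [dotProduct, ← Complex.normSq_eq_norm_sq, Complex.normSq_apply]
  have h2 : (star v ⬝ᵥ (M *ᵥ v)).re = ∑ i, ‖(B *ᵥ v) i‖ ^ 2 := by
    rw [hB, ← mulVec_mulVec, dotProduct_mulVec, ← star_mulVec]
    simp [dotProduct, ← Complex.normSq_eq_norm_sq, Complex.normSq_apply]
  rw [sub_mulVec, dotProduct_sub, Complex.sub_re, h1, h2, htr, sub_nonneg, Finset.sum_mul]
  refine Finset.sum_le_sum fun i _ => ?_
  calc ‖(B *ᵥ v) i‖ ^ 2 ≤ (∑ j, ‖B i j‖ * ‖v j‖) ^ 2 := by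
        gcongr
        simpa [mulVec, dotProduct] using norm_sum_le Finset.univ fun j => B i j * v j
    _ ≤ _ := Finset.sum_mul_sq_le_sq_mul_sq _ _ _

end PosSemidef

/-! ### The trace norm -/

section TraceNorm

variable {n : Type*} [Fintype n] [DecidableEq n]

/-- The trace norm of a Hermitian matrix is the sum of the absolute values of its eigenvalues. -/
lemma traceNorm_eq_sum_abs_eigenvalues {X : Matrix n n ℂ} (hX : X.IsHermitian) :
    traceNorm X = ∑ i, |hX.eigenvalues i| := by
  have hsq : Xᴴ * X = Unitary.conjStarAlgAut ℂ _ hX.eigenvectorUnitary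
      (diagonal fun i => ((hX.eigenvalues i ^ 2 : ℝ) : ℂ)) := by
    rw [hX.eq]
    conv_lhs => rw [hX.spectral_theorem]
    rw [← map_mul, diagonal_mul_diagonal]
    congr 2
    ext i
    simp [pow_two]
  have hroots : (Xᴴ * X).charpoly.roots =
      Multiset.map (fun i => ((hX.eigenvalues i ^ 2 : ℝ) : ℂ)) Finset.univ.val := by
    rw [hsq, Unitary.conjStarAlgAut_apply, charpoly_mul_comm, ← mul_assoc]
    simp only [Unitary.coe_star_mul_self, one_mul, charpoly_diagonal]
    rw [Polynomial.roots_prod]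
    · simp only [Polynomial.roots_X_sub_C, Multiset.bind_singleton]
    · exact Finset.prod_ne_zero_iff.mpr fun i _ => Polynomial.X_sub_C_ne_zero _
  rw [(isHermitian_conjTranspose_mul_self X).roots_charpoly_eq_eigenvalues] at hroots
  have h := congrArg (fun s => (s.map fun z : ℂ => √z.re).sum) hroots
  simpa [traceNorm, Multiset.map_map, Function.comp_def, Real.sqrt_sq_eq_abs, -Complex.ofReal_pow]
    using h

lemma star_dotProduct_eigenvectorBasis {X : Matrix n n ℂ} (hX : X.IsHermitian) (i : n) :
    star (hX.eigenvectorBasis i : n → ℂ) ⬝ᵥ (hX.eigenvectorBasis i : n → ℂ) = 1 := by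
  have h := hX.eigenvectorBasis.orthonormal.1 i
  have h' := inner_self_eq_norm_sq_to_K (𝕜 := ℂ) (hX.eigenvectorBasis i)
  rw [h] at h'
  rw [EuclideanSpace.inner_eq_star_dotProduct] at h'
  rw [dotProduct_comm]
  simpa using h'

/-- The trace may be computed in the eigenvector basis of any Hermitian matrix. -/
lemma trace_eq_sum_eigenvectorBasis {X : Matrix n n ℂ} (hX : X.IsHermitian) (M : Matrix n n ℂ) :
    M.trace = ∑ i, star (hX.eigenvectorBasis i : n → ℂ) ⬝ᵥ
      (M *ᵥ (hX.eigenvectorBasis i : n → ℂ)) := by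
  have h : M.trace =
      (star (hX.eigenvectorUnitary : Matrix n n ℂ) * (M * hX.eigenvectorUnitary)).trace := by
    rw [trace_mul_comm, mul_assoc]
    simp
  rw [h, trace]
  refine Finset.sum_congr rfl fun i _ => ?_
  simp [mul_apply, dotProduct, mulVec, star_apply]

lemma traceNorm_sub_le {φ γ : Matrix n n ℂ} (hφ : φ.PosSemidef) (hγ : γ.PosSemidef) :
    traceNorm (φ - γ) ≤ φ.trace.re + γ.trace.re := by
  have hX : (φ - γ).IsHermitian := hφ.isHermitian.sub hγ.isHermitian
  rw [traceNorm_eq_sum_abs_eigenvalues hX, trace_eq_sum_eigenvectorBasis hX φ,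
    trace_eq_sum_eigenvectorBasis hX γ, Complex.re_sum, Complex.re_sum, ← Finset.sum_add_distrib]
  refine Finset.sum_le_sum fun i _ => ?_
  have h1 := hφ.re_dotProduct_nonneg (hX.eigenvectorBasis i : n → ℂ)
  have h2 := hγ.re_dotProduct_nonneg (hX.eigenvectorBasis i : n → ℂ)
  have h3 := hX.eigenvalues_eq i
  rw [sub_mulVec, dotProduct_sub, map_sub] at h3
  simp only [RCLike.re_to_complex] at h1 h2 h3
  rw [h3, abs_le]
  constructor <;> linarith

lemma trace_mul_re_le_traceNorm {Q X : Matrix n n ℂ} (hX : X.IsHermitian) (hQ : Qᴴ * Q = 1) :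
    (Q * X).trace.re ≤ traceNorm X := by
  rw [traceNorm_eq_sum_abs_eigenvalues hX, trace_eq_sum_eigenvectorBasis hX, Complex.re_sum]
  refine Finset.sum_le_sum fun i _ => ?_
  set v : n → ℂ := (hX.eigenvectorBasis i : n → ℂ) with hv
  have hvv : star v ⬝ᵥ v = 1 := star_dotProduct_eigenvectorBasis hX i
  have hnorm : ∀ w : n → ℂ, star w ⬝ᵥ w = 1 → ‖WithLp.toLp 2 w‖ = 1 := by
    intro w hw
    have h' := inner_self_eq_norm_sq_to_K (𝕜 := ℂ) (WithLp.toLp 2 w)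
    rw [EuclideanSpace.inner_toLp_toLp, dotProduct_comm, hw] at h'
    rw [← RCLike.ofReal_pow, ← RCLike.ofReal_one, RCLike.ofReal_inj] at h'
    nlinarith [norm_nonneg (WithLp.toLp 2 w)]
  have hQv : star (Q *ᵥ v) ⬝ᵥ (Q *ᵥ v) = 1 := by
    rw [star_mulVec, ← dotProduct_mulVec, mulVec_mulVec, hQ, one_mulVec, hvv]
  have hle : ‖star v ⬝ᵥ (Q *ᵥ v)‖ ≤ 1 := by
    have := norm_inner_le_norm (𝕜 := ℂ) (WithLp.toLp 2 v) (WithLp.toLp 2 (Q *ᵥ v))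
    rwa [EuclideanSpace.inner_toLp_toLp, hnorm v hvv, hnorm _ hQv, dotProduct_comm, one_mul] at this
  have hXv : X *ᵥ v = (hX.eigenvalues i) • v := hX.mulVec_eigenvectorBasis i
  rw [← mulVec_mulVec, hXv, mulVec_smul, dotProduct_smul]
  refine (Complex.re_le_norm _).trans ?_
  rw [norm_smul, Real.norm_eq_abs]
  exact mul_le_of_le_one_right (abs_nonneg _) hle

end TraceNorm

/-! ### The cone of separable matrices -/

section SepCone

variable {A B A' B' : Type*}

/-- The convex cone of (unnormalized) separable matrices: finite sums of products of positive
semidefinite matrices. Nonnegative scalars are absorbed into the factors. -/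
def sepCone (A B : Type*) : AddSubmonoid (Matrix (A × B) (A × B) ℂ) :=
  AddSubmonoid.closure {τ | ∃ (α : Matrix A A ℂ) (β : Matrix B B ℂ),
    α.PosSemidef ∧ β.PosSemidef ∧ τ = α ⊗ₖ β}

lemma kronecker_mem_sepCone {α : Matrix A A ℂ} {β : Matrix B B ℂ} (hα : α.PosSemidef)
    (hβ : β.PosSemidef) : α ⊗ₖ β ∈ sepCone A B :=
  AddSubmonoid.subset_closure ⟨α, β, hα, hβ, rfl⟩

/-- An additive map sends the separable cone into a submonoid as soon as it does so for
products. -/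
lemma map_mem_of_mem_sepCone {M : Type*} [AddCommMonoid M]
    (F : Matrix (A × B) (A × B) ℂ →+ M) (N : AddSubmonoid M)
    (h : ∀ (α : Matrix A A ℂ) (β : Matrix B B ℂ), α.PosSemidef → β.PosSemidef → F (α ⊗ₖ β) ∈ N)
    {σ : Matrix (A × B) (A × B) ℂ} (hσ : σ ∈ sepCone A B) : F σ ∈ N := by
  have hle : sepCone A B ≤ N.comap F := AddSubmonoid.closure_le.mpr <| by
    rintro _ ⟨α, β, hα, hβ, rfl⟩
    exact h α β hα hβ
  exact hle hσ

lemma smul_mem_sepCone {c : ℝ} (hc : 0 ≤ c) {σ : Matrix (A × B) (A × B) ℂ}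
    (hσ : σ ∈ sepCone A B) : c • σ ∈ sepCone A B := by
  refine map_mem_of_mem_sepCone (DistribSMul.toAddMonoidHom _ c) _ (fun α β hα hβ => ?_) hσ
  simpa [smul_kronecker] using kronecker_mem_sepCone (hα.smul hc) hβ

lemma posSemidef_of_mem_sepCone [Finite A] [Finite B] {σ : Matrix (A × B) (A × B) ℂ}
    (hσ : σ ∈ sepCone A B) : σ.PosSemidef :=
  map_mem_of_mem_sepCone (AddMonoidHom.id _)
    { carrier := {X : Matrix (A × B) (A × B) ℂ | X.PosSemidef}
      add_mem' := fun h h' => h.add h'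
      zero_mem' := .zero } (fun _ _ hα hβ => hα.kronecker hβ) hσ

lemma conj_kronecker_mem_sepCone [Fintype A] [Fintype B] [Finite A'] [Finite B']
    {σ : Matrix (A × B) (A × B) ℂ}
    (hσ : σ ∈ sepCone A B) (K : Matrix A' A ℂ) (L : Matrix B' B ℂ) :
    (K ⊗ₖ L) * σ * (K ⊗ₖ L)ᴴ ∈ sepCone A' B' := by
  refine map_mem_of_mem_sepCone
    { toFun := fun σ : Matrix (A × B) (A × B) ℂ =>
        ((K ⊗ₖ L) * σ * (K ⊗ₖ L)ᴴ : Matrix (A' × B') (A' × B') ℂ)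
      map_zero' := by simp
      map_add' := fun X Y => by rw [Matrix.mul_add, Matrix.add_mul] } _ (fun α β hα hβ => ?_) hσ
  convert kronecker_mem_sepCone (hα.mul_mul_conjTranspose_same K)
    (hβ.mul_mul_conjTranspose_same L) using 1
  rw [mul_kronecker_mul, mul_kronecker_mul, conjTranspose_kronecker]
  rfl

variable [Fintype A] [Fintype B]

lemma IsSeparable.mem_sepCone {σ : Matrix (A × B) (A × B) ℂ} (hσ : IsSeparable σ) :
    σ ∈ sepCone A B := by
  have hconv : Convex ℝ (sepCone A B : Set (Matrix (A × B) (A × B) ℂ)) :=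
    fun x hx y hy s t hs ht _ => add_mem (smul_mem_sepCone hs hx) (smul_mem_sepCone ht hy)
  refine convexHull_min ?_ hconv hσ
  rintro _ ⟨α, β, hα, hβ, rfl⟩
  exact kronecker_mem_sepCone hα.posSemidef hβ.posSemidef

lemma IsSeparable.trace_eq_one {σ : Matrix (A × B) (A × B) ℂ} (hσ : IsSeparable σ) :
    σ.trace = 1 := by
  have hconv : Convex ℝ {X : Matrix (A × B) (A × B) ℂ | X.trace = 1} := by
    intro x hx y hy s t _ _ hst
    simp only [Set.mem_ofPred_eq] at hx hy ⊢
    rw [trace_add, trace_smul, trace_smul, hx, hy, ← add_smul, hst, one_smul]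
  refine convexHull_min ?_ hconv hσ
  rintro _ ⟨α, β, hα, hβ, rfl⟩
  simp [trace_kronecker, hα.trace_eq_one, hβ.trace_eq_one]

lemma _root_.Matrix.PosSemidef.eq_zero_or_exists_isState {n : Type*} [Fintype n]
    {α : Matrix n n ℂ} (hα : α.PosSemidef) :
    α = 0 ∨ ∃ (t : ℝ) (ρ : Matrix n n ℂ), 0 < t ∧ IsState ρ ∧ α = t • ρ := by
  rcases hα.trace_re_nonneg.eq_or_lt with h | h
  · left
    rw [← hα.trace_eq_zero_iff, hα.trace_eq_ofReal, ← h, Complex.ofReal_zero]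
  · refine .inr ⟨α.trace.re, α.trace.re⁻¹ • α, h, ⟨hα.smul (inv_nonneg.mpr h.le), ?_⟩, ?_⟩
    · rw [trace_smul, hα.trace_eq_ofReal, Complex.real_smul, ← Complex.ofReal_mul,
        Complex.ofReal_re, inv_mul_cancel₀ h.ne', Complex.ofReal_one]
    · rw [smul_smul, mul_inv_cancel₀ h.ne', one_smul]

/-- Every nonzero element of the separable cone is a positive multiple of a separable state. -/
lemma eq_zero_or_exists_isSeparable {σ : Matrix (A × B) (A × B) ℂ} (hσ : σ ∈ sepCone A B) :
    σ = 0 ∨ ∃ (t : ℝ) (τ : Matrix (A × B) (A × B) ℂ), 0 < t ∧ IsSeparable τ ∧ σ = t • τ := by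
  induction hσ using AddSubmonoid.closure_induction with
  | mem x hx =>
    obtain ⟨α, β, hα, hβ, rfl⟩ := hx
    rcases hα.eq_zero_or_exists_isState with rfl | ⟨s, ρ, hs, hρ, rfl⟩
    · simp
    rcases hβ.eq_zero_or_exists_isState with rfl | ⟨t, τ, ht, hτ, rfl⟩
    · simp
    refine .inr ⟨s * t, ρ ⊗ₖ τ, mul_pos hs ht, subset_convexHull _ _ ⟨ρ, τ, hρ, hτ, rfl⟩, ?_⟩
    rw [smul_kronecker, kronecker_smul, smul_smul]
  | zero => exact .inl rfl
  | add x y _ _ hx hy =>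
    rcases hx with rfl | ⟨s, ρ, hs, hρ, rfl⟩
    · simpa using hy
    rcases hy with rfl | ⟨t, τ, ht, hτ, rfl⟩
    · exact .inr ⟨s, ρ, hs, hρ, by simp⟩
    refine .inr ⟨s + t, (s / (s + t)) • ρ + (t / (s + t)) • τ, add_pos hs ht,
      convex_convexHull _ _ hρ hτ (by positivity) (by positivity) (by field_simp), ?_⟩
    rw [smul_add, smul_smul, smul_smul, mul_div_cancel₀ _ (add_pos hs ht).ne',
      mul_div_cancel₀ _ (add_pos hs ht).ne']

end SepCone

/-! ### Contraction against a Choi matrix -/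

section Link

variable {r a b A B : Type*} [Fintype a]

/-- The result of applying to the second factor of `X` the map with Choi matrix `J`. The sum is over
equal row and equal column indices of the common factor, without the transposition that the trace
pairing would have. -/
def link (X : Matrix (r × a) (r × a) ℂ) (J : Matrix (a × b) (a × b) ℂ) :
    Matrix (r × b) (r × b) ℂ :=
  of fun x y => ∑ s, ∑ t, X (x.1, s) (y.1, t) * J (s, x.2) (t, y.2)

lemma link_add_left (X Y : Matrix (r × a) (r × a) ℂ) (J : Matrix (a × b) (a × b) ℂ) :
    link (X + Y) J = link X J + link Y J := by
  ext
  simp [link, add_mul, Finset.sum_add_distrib]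

lemma link_add_right (X : Matrix (r × a) (r × a) ℂ) (J K : Matrix (a × b) (a × b) ℂ) :
    link X (J + K) = link X J + link X K := by
  ext
  simp [link, mul_add, Finset.sum_add_distrib]

lemma link_sub_left (X Y : Matrix (r × a) (r × a) ℂ) (J : Matrix (a × b) (a × b) ℂ) :
    link (X - Y) J = link X J - link Y J := by
  ext
  simp [link, sub_mul, Finset.sum_sub_distrib]

lemma link_sub_right (X : Matrix (r × a) (r × a) ℂ) (J K : Matrix (a × b) (a × b) ℂ) :
    link X (J - K) = link X J - link X K := by
  ext
  simp [link, mul_sub, Finset.sum_sub_distrib]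

lemma posSemidef_link [Fintype r] [Fintype b] {X : Matrix (r × a) (r × a) ℂ}
    {J : Matrix (a × b) (a × b) ℂ} (hX : X.PosSemidef) (hJ : J.PosSemidef) :
    (link X J).PosSemidef := by
  have h := posSemidef_sum_blocks
    ((hX.kronecker hJ).submatrix fun z : (r × b) × a => ((z.1.1, z.2), (z.2, z.1.2)))
  convert h using 1
  ext x y
  simp [link, kroneckerMap_apply]

/-- Linking with an element of the separable cone yields separable matrices: a map with separable
Choi matrix is entanglement breaking. -/
lemma link_mem_sepCone [Fintype r] {X : Matrix (r × a) (r × a) ℂ}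
    {S : Matrix (a × b) (a × b) ℂ} (hX : X.PosSemidef) (hS : S ∈ sepCone a b) :
    link X S ∈ sepCone r b := by
  refine map_mem_of_mem_sepCone
    { toFun := link X
      map_zero' := by ext; simp [link]
      map_add' := link_add_right X } _ (fun α β hα hβ => ?_) hS
  have hα' : (α.submatrix Prod.fst Prod.fst : Matrix (a × Unit) (a × Unit) ℂ).PosSemidef :=
    hα.submatrix _
  convert kronecker_mem_sepCone ((posSemidef_link hX hα').submatrix fun u => (u, ())) hβ using 1
  ext x y
  simp [link, kroneckerMap_apply, Finset.sum_mul, mul_assoc]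

/-- The partial trace over the second factor. -/
def traceSnd [Fintype b] (J : Matrix (a × b) (a × b) ℂ) : Matrix a a ℂ :=
  of fun s t => ∑ x, J (s, x) (t, x)

lemma trace_link_re_le [Fintype r] [Fintype b] [DecidableEq a] {X : Matrix (r × a) (r × a) ℂ}
    {J : Matrix (a × b) (a × b) ℂ} {c : ℝ} (hX : X.PosSemidef)
    (hJ : (c • (1 : Matrix a a ℂ) - traceSnd J).PosSemidef) :
    (link X J).trace.re ≤ c * X.trace.re := by
  set N := c • (1 : Matrix a a ℂ) - traceSnd J with hN
  have h := (posSemidef_link hX (hJ.submatrix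
    (Prod.fst : a × Unit → a))).trace_re_nonneg
  have htr : (link X (N.submatrix (Prod.fst : a × Unit → a) Prod.fst)).trace
      = c • X.trace - (link X J).trace := by
    simp [hN, link, trace, traceSnd, Fintype.sum_prod_type, mul_sub, Finset.sum_sub_distrib,
      one_apply, Finset.mul_sum,
      mul_comm]
    refine Finset.sum_congr rfl fun u _ => ?_
    rw [Finset.sum_comm_cycle, Finset.sum_comm_cycle]
  rw [htr, Complex.sub_re, Complex.smul_re, smul_eq_mul] at h
  linarith

/-- The link product on the middle factor of a matrix on `A ⊗ A' ⊗ B`, read as in `applyMid`. -/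
def linkMid (X : Matrix ((A × a) × B) ((A × a) × B) ℂ) (J : Matrix (a × b) (a × b) ℂ) :
    Matrix (A × (b × B)) (A × (b × B)) ℂ :=
  (link (X.submatrix (fun z : (A × B) × a => ((z.1.1, z.2), z.1.2))
    (fun z : (A × B) × a => ((z.1.1, z.2), z.1.2))) J).submatrix
      (fun z => ((z.1, z.2.2), z.2.1)) (fun z => ((z.1, z.2.2), z.2.1))

lemma posSemidef_linkMid [Fintype A] [Fintype B] [Fintype b]
    {X : Matrix ((A × a) × B) ((A × a) × B) ℂ} {J : Matrix (a × b) (a × b) ℂ}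
    (hX : X.PosSemidef) (hJ : J.PosSemidef) : (linkMid X J).PosSemidef :=
  (posSemidef_link (hX.submatrix _) hJ).submatrix _

lemma linkMid_mem_sepCone [Fintype A] [Finite B] [Finite b]
    {X : Matrix ((A × a) × B) ((A × a) × B) ℂ} {S : Matrix (a × b) (a × b) ℂ}
    (hX : X ∈ sepCone (A × a) B) (hS : S ∈ sepCone a b) : linkMid X S ∈ sepCone A (b × B) := by
  refine map_mem_of_mem_sepCone
    { toFun := fun X => linkMid X S
      map_zero' := by ext; simp [linkMid, link]
      map_add' := fun X Y => by simp [linkMid, submatrix_add, link_add_left] } _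
    (fun α β hα hβ => ?_) hX
  have hassoc : ∀ {τ : Matrix (A × b) (A × b) ℂ}, τ ∈ sepCone A b →
      ((τ ⊗ₖ β).submatrix (Equiv.prodAssoc A b B).symm (Equiv.prodAssoc A b B).symm)
        ∈ sepCone A (b × B) := by
    intro τ hτ
    refine map_mem_of_mem_sepCone
      { toFun := fun τ : Matrix (A × b) (A × b) ℂ =>
          (τ ⊗ₖ β).submatrix (Equiv.prodAssoc A b B).symm (Equiv.prodAssoc A b B).symm
        map_zero' := by simp
        map_add' := fun X Y => by simp [add_kronecker, submatrix_add] } _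
      (fun α' β' hα' hβ' => ?_) hτ
    convert kronecker_mem_sepCone hα' (hβ'.kronecker hβ) using 1
    ext
    simp [kroneckerMap_apply, mul_assoc]
  convert hassoc (link_mem_sepCone hα hS) using 1
  ext x y
  simp [linkMid, link, kroneckerMap_apply, Finset.sum_mul, mul_right_comm]

lemma trace_linkMid_re_le [Fintype A] [Fintype B] [Fintype b] [DecidableEq a]
    {X : Matrix ((A × a) × B) ((A × a) × B) ℂ} {J : Matrix (a × b) (a × b) ℂ} {c : ℝ}
    (hX : X.PosSemidef) (hJ : (c • (1 : Matrix a a ℂ) - traceSnd J).PosSemidef) :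
    (linkMid X J).trace.re ≤ c * X.trace.re := by
  have h := trace_link_re_le
    (hX.submatrix fun z : (A × B) × a => ((z.1.1, z.2), z.1.2)) hJ
  have h1 : (X.submatrix (fun z : (A × B) × a => ((z.1.1, z.2), z.1.2))
      (fun z : (A × B) × a => ((z.1.1, z.2), z.1.2))).trace = X.trace := by
    simp only [trace, Fintype.sum_prod_type, diag_apply, submatrix_apply]
    exact Finset.sum_congr rfl fun _ _ => Finset.sum_comm
  rw [h1] at h
  convert h using 2
  simp only [linkMid, trace, Fintype.sum_prod_type, diag_apply, submatrix_apply]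
  exact Finset.sum_congr rfl fun _ _ => Finset.sum_comm

end Link

/-! ### LOCC-operations -/

section LOCC

lemma _root_.Matrix.trace_submatrix_self_equiv {m n : Type*} [Fintype m] [Fintype n] (e : m ≃ n)
    (X : Matrix n n ℂ) : (X.submatrix e e).trace = X.trace :=
  e.sum_comp fun i => X i i

lemma trace_sum_conj_kronecker {A B A' B' I J : Type*} [Fintype A] [Fintype B] [Fintype A']
    [Fintype B'] [Fintype I] [Fintype J] [DecidableEq A] [DecidableEq B]
    {KA : I → Matrix A' A ℂ} {KB : J → Matrix B' B ℂ}
    (hA : ∑ i, (KA i)ᴴ * KA i = 1) (hB : ∑ j, (KB j)ᴴ * KB j = 1)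
    (X : Matrix (A × B) (A × B) ℂ) :
    ∑ i, ∑ j, ((KA i ⊗ₖ KB j) * X * (KA i ⊗ₖ KB j)ᴴ).trace = X.trace := by
  have hterm : ∀ i j, ((KA i ⊗ₖ KB j) * X * (KA i ⊗ₖ KB j)ᴴ).trace
      = ((((KA i)ᴴ * KA i) ⊗ₖ ((KB j)ᴴ * KB j)) * X).trace := by
    intro i j
    rw [trace_mul_comm, ← Matrix.mul_assoc, conjTranspose_kronecker, mul_kronecker_mul]
  have hsum : ∑ i, ∑ j, (((KA i)ᴴ * KA i) ⊗ₖ ((KB j)ᴴ * KB j)) = 1 := by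
    rw [← one_kronecker_one, ← hA, ← hB]
    ext x y
    simp only [Matrix.sum_apply, kroneckerMap_apply, Finset.sum_mul_sum]
  simp_rw [hterm, ← trace_sum, ← Matrix.sum_mul, hsum, Matrix.one_mul]

/-- Appending registers in product form preserves separability. -/
lemma kronecker_prodProdProdComm_mem_sepCone {A B I J : Type*} {τ : Matrix (A × B) (A × B) ℂ}
    [Finite A] [Finite B] [Finite I] [Finite J]
    (hτ : τ ∈ sepCone A B) {P : Matrix J J ℂ} {Q : Matrix I I ℂ} (hP : P.PosSemidef)
    (hQ : Q.PosSemidef) :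
    (τ ⊗ₖ (P ⊗ₖ Q)).submatrix (Equiv.prodProdProdComm A J B I) (Equiv.prodProdProdComm A J B I)
      ∈ sepCone (A × J) (B × I) := by
  refine map_mem_of_mem_sepCone
    { toFun := fun τ : Matrix (A × B) (A × B) ℂ => (τ ⊗ₖ (P ⊗ₖ Q)).submatrix
        (Equiv.prodProdProdComm A J B I) (Equiv.prodProdProdComm A J B I)
      map_zero' := by simp
      map_add' := fun X Y => by simp [add_kronecker, submatrix_add] } _
    (fun α β hα hβ => ?_) hτ
  convert kronecker_mem_sepCone (hα.kronecker hP) (hβ.kronecker hQ) using 1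
  ext
  exact mul_mul_mul_comm _ _ _ _

lemma posSemidef_single {n : Type*} [Finite n] [DecidableEq n] (i : n) :
    (single i i (1 : ℂ)).PosSemidef := by
  have := Fintype.ofFinite n
  rw [← diagonal_single]
  exact .diagonal fun j => by
    rcases eq_or_ne i j with rfl | h
    · simp
    · simp [Pi.single_eq_of_ne' h]

variable {A B A' B' : Type} {L : Matrix (A × B) (A × B) ℂ →ₗ[ℂ] Matrix (A' × B') (A' × B') ℂ}

lemma IsLOCC.finite (hL : IsLOCC L) : Finite A ∧ Finite B ∧ Finite A' ∧ Finite B' := by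
  induction hL with
  | round => exact ⟨inferInstance, inferInstance, inferInstance, inferInstance⟩
  | loc => exact ⟨inferInstance, inferInstance, inferInstance, inferInstance⟩
  | comp _ _ hM hL => exact ⟨hL.1, hL.2.1, hM.2.2.1, hM.2.2.2⟩

lemma IsLOCC.posSemidef (hL : IsLOCC L) {X : Matrix (A × B) (A × B) ℂ} (hX : X.PosSemidef) :
    (L X).PosSemidef := by
  induction hL with
  | round KA KB hA hB =>
    exact posSemidef_sum _ fun i _ => posSemidef_sum _ fun j _ =>
      ((hX.mul_mul_conjTranspose_same _).kronecker
        ((posSemidef_single j).kronecker (posSemidef_single i))).submatrix _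
  | loc KA KB hA hB =>
    exact posSemidef_sum _ fun i _ => posSemidef_sum _ fun j _ => hX.mul_mul_conjTranspose_same _
  | comp _ _ hM hL => exact hM (hL hX)

lemma IsLOCC.mem_sepCone (hL : IsLOCC L) {X : Matrix (A × B) (A × B) ℂ}
    (hX : X ∈ sepCone A B) : L X ∈ sepCone A' B' := by
  induction hL with
  | round KA KB hA hB =>
    exact sum_mem fun i _ => sum_mem fun j _ => kronecker_prodProdProdComm_mem_sepCone
      (conj_kronecker_mem_sepCone hX _ _) (posSemidef_single j) (posSemidef_single i)
  | loc KA KB hA hB =>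
    exact sum_mem fun i _ => sum_mem fun j _ => conj_kronecker_mem_sepCone hX _ _
  | comp _ _ hM hL => exact hM (hL hX)

/-- LOCC-operations preserve the trace. The instances are explicit arguments so that the induction
can replace them by those that the constructors of `IsLOCC` carry. -/
lemma IsLOCC.trace (hL : IsLOCC L) (iAB : Fintype (A × B)) (iAB' : Fintype (A' × B'))
    (X : Matrix (A × B) (A × B) ℂ) : (L X).trace = X.trace := by
  induction hL with
  | round KA KB hA hB =>
    rw [Subsingleton.elim iAB (instFintypeProd _ _), Subsingleton.elim iAB' (instFintypeProd _ _)]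
    rw [← trace_sum_conj_kronecker hA hB X]
    simp only [loccRound, LinearMap.coe_mk, AddHom.coe_mk, trace_sum, trace_submatrix_self_equiv,
      trace_kronecker, trace_single_eq_same, mul_one]
  | loc KA KB hA hB =>
    rw [Subsingleton.elim iAB (instFintypeProd _ _), Subsingleton.elim iAB' (instFintypeProd _ _)]
    rw [← trace_sum_conj_kronecker hA hB X]
    simp only [localChannels, LinearMap.coe_mk, AddHom.coe_mk, trace_sum]
  | @comp A B C D A' B' L M hM hL ihM ihL =>
    obtain ⟨hC, hD, -, -⟩ := hM.finite
    have := Fintype.ofFinite C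
    have := Fintype.ofFinite D
    exact (ihM inferInstance iAB' _).trans (ihL iAB inferInstance _)

end LOCC

/-! ### Channels and their Choi matrices -/

section Choi

variable {r a b A B : Type*}

/-- The Choi matrix `∑ s t, |s⟩⟨t| ⊗ T (|s⟩⟨t|)`. -/
def choi [DecidableEq a] (T : Matrix a a ℂ →ₗ[ℂ] Matrix b b ℂ) : Matrix (a × b) (a × b) ℂ :=
  of fun x y => T (single x.1 y.1 1) x.2 y.2

lemma apply_eq_sum_choi [Fintype a] [DecidableEq a] (T : Matrix a a ℂ →ₗ[ℂ] Matrix b b ℂ)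
    (M : Matrix a a ℂ) (x y : b) :
    T M x y = ∑ s, ∑ t, M s t * choi T (s, x) (t, y) := by
  conv_lhs => rw [matrix_eq_sum_single M]
  simp only [map_sum, Matrix.sum_apply, choi, of_apply]
  refine Finset.sum_congr rfl fun s _ => Finset.sum_congr rfl fun t _ => ?_
  rw [show single s t (M s t) = M s t • single s t (1 : ℂ) by simp [smul_single], map_smul]
  simp

lemma applySnd_eq_link [Fintype a] [DecidableEq a] (T : Matrix a a ℂ →ₗ[ℂ] Matrix b b ℂ)
    (X : Matrix (r × a) (r × a) ℂ) :
    applySnd T X = link X (choi T) := by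
  ext x y
  simp [applySnd, link, apply_eq_sum_choi]

lemma applyMid_eq_linkMid [Fintype a] [DecidableEq a] (T : Matrix a a ℂ →ₗ[ℂ] Matrix b b ℂ)
    (X : Matrix ((A × a) × B) ((A × a) × B) ℂ) : applyMid T X = linkMid X (choi T) := by
  ext x y
  simp [applyMid, linkMid, link, apply_eq_sum_choi]

lemma IsChannel.trace_applyMid [Fintype a] [Fintype b] [Fintype A] [Fintype B]
    {T : Matrix a a ℂ →ₗ[ℂ] Matrix b b ℂ} (hT : IsChannel T)
    (X : Matrix ((A × a) × B) ((A × a) × B) ℂ) :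
    (applyMid T X).trace = X.trace := by
  have h : ∀ (u : A) (w : B), ∑ x, applyMid T X (u, (x, w)) (u, (x, w))
      = ∑ s, X ((u, s), w) ((u, s), w) :=
    fun u w => hT.tracePreserving (of fun s t => X ((u, s), w) ((u, t), w))
  simp only [trace, diag_apply, Fintype.sum_prod_type]
  refine Finset.sum_congr rfl fun u _ => ?_
  rw [Finset.sum_comm, Finset.sum_comm (γ := a)]
  exact Finset.sum_congr rfl fun w _ => h u w

/-- The unnormalized maximally entangled projector `∑ s t, |s s⟩⟨t t|`. -/
def unnormMaxEntangled (a : Type*) [DecidableEq a] : Matrix (a × a) (a × a) ℂ :=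
  vecMulVec (fun x => if x.1 = x.2 then 1 else 0) (star fun x => if x.1 = x.2 then 1 else 0)

lemma applySnd_unnormMaxEntangled [DecidableEq a] (T : Matrix a a ℂ →ₗ[ℂ] Matrix b b ℂ) :
    applySnd T (unnormMaxEntangled a) = choi T := by
  ext x y
  have h : (of fun s t => unnormMaxEntangled a (x.1, s) (y.1, t)) = single x.1 y.1 (1 : ℂ) := by
    ext s t
    simp [unnormMaxEntangled, vecMulVec_apply, single_apply, ← ite_and, apply_ite star,
      and_comm]
  simp [applySnd, choi, h]

lemma IsChannel.posSemidef_choi {a : ℕ} [Fintype b]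
    {T : Matrix (Fin a) (Fin a) ℂ →ₗ[ℂ] Matrix b b ℂ}
    (hT : IsChannel T) : (choi T).PosSemidef := by
  rw [← applySnd_unnormMaxEntangled]
  exact hT.completelyPositive a _ (posSemidef_vecMulVec_self_star _)

end Choi

/-! ### Domination of assisted states by separable matrices -/

section Assisted

variable {a b : ℕ} {T : Matrix (Fin a) (Fin a) ℂ →ₗ[ℂ] Matrix (Fin b) (Fin b) ℂ}

/-- `IsDominated c ρ`: some separable matrix of trace at most `c` dominates `ρ`. For `c = 2 ^ l`
this witnesses that the max-relative entropy of entanglement of a state `ρ` is at most `l`. -/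
def IsDominated {A B : Type*} [Fintype A] [Fintype B] (c : ℝ) (ρ : Matrix (A × B) (A × B) ℂ) :
    Prop :=
  ∃ τ ∈ sepCone A B, (τ - ρ).PosSemidef ∧ τ.trace.re ≤ c

lemma IsSeparable.isDominated {A B : Type*} [Fintype A] [Fintype B]
    {ρ : Matrix (A × B) (A × B) ℂ} (hρ : IsSeparable ρ) : IsDominated 1 ρ :=
  ⟨ρ, hρ.mem_sepCone, by simp [PosSemidef.zero], by simp [hρ.trace_eq_one]⟩

lemma IsSeparable.isState {A B : Type*} [Fintype A] [Fintype B]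
    {ρ : Matrix (A × B) (A × B) ℂ} (hρ : IsSeparable ρ) : IsState ρ :=
  ⟨posSemidef_of_mem_sepCone hρ.mem_sepCone, hρ.trace_eq_one⟩

lemma IsLOCC.isState {A B A' B' : Type} [Fintype A] [Fintype B] [Fintype A'] [Fintype B']
    {L : Matrix (A × B) (A × B) ℂ →ₗ[ℂ] Matrix (A' × B') (A' × B') ℂ} (hL : IsLOCC L)
    {ρ : Matrix (A × B) (A × B) ℂ} (hρ : IsState ρ) : IsState (L ρ) :=
  ⟨hL.posSemidef hρ.posSemidef, (hL.trace _ _ ρ).trans hρ.trace_eq_one⟩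

lemma IsLOCC.isDominated {A B A' B' : Type} [Fintype A] [Fintype B] [Fintype A'] [Fintype B']
    {L : Matrix (A × B) (A × B) ℂ →ₗ[ℂ] Matrix (A' × B') (A' × B') ℂ} (hL : IsLOCC L)
    {ρ : Matrix (A × B) (A × B) ℂ} {c : ℝ} (hρ : IsDominated c ρ) : IsDominated c (L ρ) := by
  obtain ⟨τ, hτ, hle, htr⟩ := hρ
  refine ⟨L τ, hL.mem_sepCone hτ, ?_, (congrArg Complex.re (hL.trace _ _ τ)).trans_le htr⟩
  rw [← map_sub]
  exact hL.posSemidef hle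

/-- `IsEntBreakingBound T c S`: the separable matrix `S`, the Choi matrix of an entanglement
breaking map, dominates the Choi matrix of `T`, and that map increases the trace by a factor of at
most `c`. -/
structure IsEntBreakingBound (T : Matrix (Fin a) (Fin a) ℂ →ₗ[ℂ] Matrix (Fin b) (Fin b) ℂ)
    (c : ℝ) (S : Matrix (Fin a × Fin b) (Fin a × Fin b) ℂ) : Prop where
  mem_sepCone : S ∈ sepCone (Fin a) (Fin b)
  dominates : (S - choi T).PosSemidef
  traceSnd_le : (c • (1 : Matrix (Fin a) (Fin a) ℂ) - traceSnd S).PosSemidef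

/-- One use of the channel raises the max-relative entropy of entanglement by at most the logarithm
of `c`: `T(ρ) ≤ T(τ) ≤ S(τ)`, where the last matrix is separable because `S` is entanglement
breaking and `τ` is separable. -/
lemma IsEntBreakingBound.isDominated_applyMid (hT : IsChannel T) {c d : ℝ} (hc : 0 ≤ c)
    {S : Matrix (Fin a × Fin b) (Fin a × Fin b) ℂ} (hS : IsEntBreakingBound T c S)
    {A B : Type*} [Fintype A] [Fintype B]
    {ρ : Matrix ((A × Fin a) × B) ((A × Fin a) × B) ℂ} (hρ : IsDominated d ρ) :
    IsDominated (c * d) (applyMid T ρ) := by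
  obtain ⟨τ, hτ, hle, htr⟩ := hρ
  have hτ' := posSemidef_of_mem_sepCone hτ
  refine ⟨linkMid τ S, linkMid_mem_sepCone hτ hS.mem_sepCone, ?_,
    (trace_linkMid_re_le hτ' hS.traceSnd_le).trans (mul_le_mul_of_nonneg_left htr hc)⟩
  have h : linkMid τ S - applyMid T ρ
      = linkMid τ (S - choi T) + linkMid (τ - ρ) (choi T) := by
    rw [applyMid_eq_linkMid]
    simp [linkMid, link_sub_left, link_sub_right, submatrix_sub]
  rw [h]
  exact (posSemidef_linkMid hτ' hS.dominates).add (posSemidef_linkMid hle hT.posSemidef_choi)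

lemma IsChannel.isState_applyMid (hT : IsChannel T) {A B : Type*} [Fintype A] [Fintype B]
    {ρ : Matrix ((A × Fin a) × B) ((A × Fin a) × B) ℂ} (hρ : IsState ρ) :
    IsState (applyMid T ρ) where
  posSemidef := by
    rw [applyMid_eq_linkMid]
    exact posSemidef_linkMid hρ.posSemidef hT.posSemidef_choi
  trace_eq_one := (hT.trace_applyMid ρ).trans hρ.trace_eq_one

lemma IsAssistedState.isState_and_isDominated (hT : IsChannel T) {c : ℝ} (hc : 0 ≤ c)
    {S : Matrix (Fin a × Fin b) (Fin a × Fin b) ℂ} (hS : IsEntBreakingBound T c S)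
    {m p q : ℕ} {σ : Matrix (Fin p × (Fin b × Fin q)) (Fin p × (Fin b × Fin q)) ℂ}
    (hσ : IsAssistedState T m σ) : IsState σ ∧ IsDominated (c ^ m) σ := by
  induction hσ with
  | first ρ hρ =>
    refine ⟨hT.isState_applyMid hρ.isState, ?_⟩
    simpa using hS.isDominated_applyMid hT hc hρ.isDominated
  | next σ hσ L hL ih =>
    refine ⟨hT.isState_applyMid (hL.isState ih.1), ?_⟩
    rw [pow_succ']
    exact hS.isDominated_applyMid hT hc (hL.isDominated ih.2)

lemma IsCodingOutput.isState_and_isDominated (hT : IsChannel T) {c : ℝ} (hc : 0 ≤ c)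
    {S : Matrix (Fin a × Fin b) (Fin a × Fin b) ℂ} (hS : IsEntBreakingBound T c S)
    {m : ℕ} {A B : Type} [Fintype A] [Fintype B] {φ : Matrix (A × B) (A × B) ℂ}
    (hφ : IsCodingOutput T m φ) : IsState φ ∧ IsDominated (c ^ m) φ := by
  obtain ⟨p, q, σ, L, hσ, hL, rfl⟩ := hφ
  obtain ⟨h1, h2⟩ := hσ.isState_and_isDominated hT hc hS
  exact ⟨hL.isState h1, hL.isDominated h2⟩

end Assisted

/-! ### Private states and separable states -/

section PrivateState

variable {K s : ℕ}

/-- The key block of a twisting: the matrix `∑ i, |i i⟩ ⊗ U i i` from the shield to key and shield,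
in the bipartition `A_k A_s : B_k B_s`. -/
def keyBlock (U : Fin K → Fin K → Matrix (Fin s × Fin s) (Fin s × Fin s) ℂ) :
    Matrix ((Fin K × Fin s) × (Fin K × Fin s)) (Fin s × Fin s) ℂ :=
  of fun x z => if x.1.1 = x.2.1 then U x.1.1 x.2.1 (x.1.2, x.2.2) z else 0

variable {U : Fin K → Fin K → Matrix (Fin s × Fin s) (Fin s × Fin s) ℂ}

lemma twisting_apply (x y : (Fin K × Fin K) × (Fin s × Fin s)) :
    twisting U x y = if x.1 = y.1 then U x.1.1 x.1.2 x.2 y.2 else 0 := by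
  obtain ⟨⟨i, j⟩, z⟩ := x
  obtain ⟨⟨k, l⟩, w⟩ := y
  simp only [twisting, Matrix.sum_apply, kroneckerMap_apply, single_apply, Prod.mk.injEq]
  by_cases h : i = k ∧ j = l
  · obtain ⟨rfl, rfl⟩ := h
    rw [Finset.sum_eq_single i (by intro c _ hc; simp [hc]) (by simp),
      Finset.sum_eq_single j (by intro c _ hc; simp [hc]) (by simp)]
    simp
  · rw [if_neg h]
    refine Finset.sum_eq_zero fun c _ => Finset.sum_eq_zero fun d _ => ?_
    by_cases h1 : c = i ∧ c = k
    · by_cases h2 : d = j ∧ d = l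
      · exact absurd ⟨h1.1.symm.trans h1.2, h2.1.symm.trans h2.2⟩ h
      · simp [h2]
    · simp [h1]

lemma conjTranspose_keyBlock_mul_self
    (hU : ∀ i j, U i j ∈ unitaryGroup (Fin s × Fin s) ℂ) :
    (keyBlock U)ᴴ * keyBlock U = (K : ℂ) • 1 := by
  have hUU : ∀ i, (U i i)ᴴ * U i i = 1 := fun i => (mem_unitaryGroup_iff'.mp (hU i i))
  have h : (keyBlock U)ᴴ * keyBlock U = ∑ i, (U i i)ᴴ * U i i := by
    ext z w
    simp only [mul_apply, conjTranspose_apply, keyBlock, of_apply, Matrix.sum_apply,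
      Fintype.sum_prod_type]
    refine Finset.sum_congr rfl fun i _ => ?_
    refine Finset.sum_congr rfl fun p _ => ?_
    rw [Finset.sum_eq_single i (by intro c _ hc; simp [hc.symm]) (by simp)]
    simp
  rw [h]
  simp [hUU, ← Nat.cast_smul_eq_nsmul ℂ]

/-- A private state only involves the diagonal unitaries of its twisting. -/
lemma twisted_maxEntangled_eq (σ : Matrix (Fin s × Fin s) (Fin s × Fin s) ℂ) :
    (twisting U * (maxEntangled K ⊗ₖ σ) * (twisting U)ᴴ).submatrix
      (Equiv.prodProdProdComm (Fin K) (Fin s) (Fin K) (Fin s))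
      (Equiv.prodProdProdComm (Fin K) (Fin s) (Fin K) (Fin s))
      = (K : ℂ)⁻¹ • (keyBlock U * σ * (keyBlock U)ᴴ) := by
  have hleft : ∀ (x : (Fin K × Fin K) × (Fin s × Fin s)) 
      (M : Matrix _ ((Fin K × Fin K) × (Fin s × Fin s)) ℂ) y,
      (twisting U * M) x y = ∑ z, U x.1.1 x.1.2 x.2 z * M (x.1, z) y := by
    intro x M y
    simp only [mul_apply, Fintype.sum_prod_type (α₁ := Fin K × Fin K)
      (α₂ := Fin s × Fin s), twisting_apply]
    rw [Finset.sum_eq_single x.1 (by intro c _ hc; simp [hc.symm]) (by simp)]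
    simp
  have hright : ∀ (M : Matrix ((Fin K × Fin K) × (Fin s × Fin s)) _ ℂ) x
      (y : (Fin K × Fin K) × (Fin s × Fin s)),
      (M * (twisting U)ᴴ) x y = ∑ w, M x (y.1, w) * star (U y.1.1 y.1.2 y.2 w) := by
    intro M x y
    simp only [mul_apply, Fintype.sum_prod_type (α₁ := Fin K × Fin K)
      (α₂ := Fin s × Fin s), twisting_apply, conjTranspose_apply]
    rw [Finset.sum_eq_single y.1 (by intro c _ hc; simp [hc.symm]) (by simp)]
    simp
  ext x y
  rw [submatrix_apply, hright]
  simp only [hleft, Equiv.prodProdProdComm_apply, kroneckerMap_apply, maxEntangled, of_apply,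
    Matrix.smul_apply, mul_apply, conjTranspose_apply, keyBlock, smul_eq_mul]
  by_cases hx : x.1.1 = x.2.1
  · by_cases hy : y.1.1 = y.2.1
    · simp only [hx, hy, and_self, if_true, Finset.mul_sum, Finset.sum_mul]
      refine Finset.sum_congr rfl fun z _ => Finset.sum_congr rfl fun w _ => ?_
      ring
    · simp [hy]
  · simp [hx]

lemma sum_norm_sq_unitary_mulVec {n : Type*} [Fintype n] [DecidableEq n] {V : Matrix n n ℂ}
    (hV : V ∈ unitaryGroup n ℂ) (c : n → ℂ) :
    ∑ z, ‖∑ y, c y * V y z‖ ^ 2 = ∑ y, ‖c y‖ ^ 2 := by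
  have h : ∀ w : n → ℂ, ((∑ y, ‖w y‖ ^ 2 : ℝ) : ℂ) = w ⬝ᵥ star w := by
    intro w
    simp [dotProduct, Complex.mul_conj, Complex.normSq_eq_norm_sq]
  apply Complex.ofReal_injective
  rw [h c]
  refine (h (c ᵥ* V)).trans ?_
  rw [star_vecMul, dotProduct_mulVec, vecMul_vecMul]
  rw [show V * Vᴴ = 1 from mem_unitaryGroup_iff.mp hV, vecMul_one]

/-- The overlap of the key block with a product vector: the shield unitaries preserve the norms of
the components with equal key values, whose sum is bounded by the Cauchy-Schwarz inequality. -/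
lemma sum_norm_sq_keyBlock_le (hU : ∀ i j, U i j ∈ unitaryGroup (Fin s × Fin s) ℂ)
    (f g : Fin K × Fin s → ℂ) :
    ∑ z, ‖∑ x, f x.1 * g x.2 * keyBlock U x z‖ ^ 2 ≤ (∑ x, ‖f x‖ ^ 2) * ∑ x, ‖g x‖ ^ 2 := by
  let ψ : Fin K → EuclideanSpace ℂ (Fin s × Fin s) := fun i =>
    WithLp.toLp 2 fun z => ∑ y : Fin s × Fin s, (f (i, y.1) * g (i, y.2)) * U i i y z
  have hψ : ∀ i, ‖ψ i‖ ^ 2 = (∑ p, ‖f (i, p)‖ ^ 2) * ∑ q, ‖g (i, q)‖ ^ 2 := by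
    intro i
    rw [EuclideanSpace.norm_sq_eq]
    refine (sum_norm_sq_unitary_mulVec (hU i i)
      fun y : Fin s × Fin s => f (i, y.1) * g (i, y.2)).trans ?_
    simp [Fintype.sum_prod_type, Finset.sum_mul_sum, mul_pow]
  have hsum : ∑ z, ‖∑ x, f x.1 * g x.2 * keyBlock U x z‖ ^ 2 = ‖∑ i, ψ i‖ ^ 2 := by
    rw [EuclideanSpace.norm_sq_eq]
    refine Finset.sum_congr rfl fun z _ => ?_
    congr 2
    simp only [ψ, keyBlock, of_apply, Fintype.sum_prod_type, WithLp.ofLp_sum, Finset.sum_apply]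
    refine Finset.sum_congr rfl fun i _ => Finset.sum_congr rfl fun p _ => ?_
    rw [Finset.sum_eq_single i (by intro c _ hc; simp [hc.symm]) (by simp)]
    simp
  have hpsi : ∀ i, ‖ψ i‖ = √(∑ p, ‖f (i, p)‖ ^ 2) * √(∑ q, ‖g (i, q)‖ ^ 2) := by
    intro i
    rw [← Real.sqrt_mul (by positivity), ← hψ, Real.sqrt_sq (norm_nonneg _)]
  calc ∑ z, ‖∑ x, f x.1 * g x.2 * keyBlock U x z‖ ^ 2 = ‖∑ i, ψ i‖ ^ 2 := hsum
    _ ≤ (∑ i, ‖ψ i‖) ^ 2 := by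
      gcongr
      exact norm_sum_le _ _
    _ ≤ (∑ i, √(∑ p, ‖f (i, p)‖ ^ 2) ^ 2) * ∑ i, √(∑ q, ‖g (i, q)‖ ^ 2) ^ 2 := by
      simp only [hpsi]
      exact Finset.sum_mul_sq_le_sq_mul_sq _ _ _
    _ = (∑ x, ‖f x‖ ^ 2) * ∑ x, ‖g x‖ ^ 2 := by
      have hsq : ∀ h : Fin K × Fin s → ℂ,
          ∑ i, √(∑ p, ‖h (i, p)‖ ^ 2) ^ 2 = ∑ x, ‖h x‖ ^ 2 := by
        intro h
        rw [Fintype.sum_prod_type]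
        exact Finset.sum_congr rfl fun i _ => Real.sq_sqrt (by positivity)
      rw [hsq, hsq]

lemma trace_mul_conjTranspose_self_re {m n : Type*} [Fintype m] [Fintype n] (M : Matrix m n ℂ) :
    (M * Mᴴ).trace.re = ∑ i, ∑ j, ‖M i j‖ ^ 2 := by
  simp [trace, mul_apply, ← Complex.normSq_eq_norm_sq, Complex.normSq_apply]

lemma trace_conjTranspose_mul_self_re {m n : Type*} [Fintype m] [Fintype n] (M : Matrix m n ℂ) :
    (Mᴴ * M).trace.re = ∑ i, ∑ j, ‖M i j‖ ^ 2 := by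
  rw [trace_mul_comm, trace_mul_conjTranspose_self_re]

lemma trace_keyBlock_kronecker_re_le (hU : ∀ i j, U i j ∈ unitaryGroup (Fin s × Fin s) ℂ)
    {α β : Matrix (Fin K × Fin s) (Fin K × Fin s) ℂ} (hα : α.PosSemidef) (hβ : β.PosSemidef) :
    ((keyBlock U)ᴴ * (α ⊗ₖ β) * keyBlock U).trace.re ≤ (α ⊗ₖ β).trace.re := by
  obtain ⟨F, rfl⟩ := exists_eq_conjTranspose_mul_self hα
  obtain ⟨G, rfl⟩ := exists_eq_conjTranspose_mul_self hβ
  have h : (keyBlock U)ᴴ * ((Fᴴ * F) ⊗ₖ (Gᴴ * G)) * keyBlock U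
      = ((F ⊗ₖ G) * keyBlock U)ᴴ * ((F ⊗ₖ G) * keyBlock U) := by
    rw [mul_kronecker_mul, ← conjTranspose_kronecker, conjTranspose_mul]
    simp only [Matrix.mul_assoc]
  rw [h, trace_conjTranspose_mul_self_re, mul_kronecker_mul, ← conjTranspose_kronecker,
    trace_conjTranspose_mul_self_re]
  refine Finset.sum_le_sum fun x _ => ?_
  calc ∑ z, ‖((F ⊗ₖ G) * keyBlock U) x z‖ ^ 2
      = ∑ z, ‖∑ y, F x.1 y.1 * G x.2 y.2 * keyBlock U y z‖ ^ 2 := by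
        simp [mul_apply, kroneckerMap_apply]
    _ ≤ (∑ y, ‖F x.1 y‖ ^ 2) * ∑ y, ‖G x.2 y‖ ^ 2 := sum_norm_sq_keyBlock_le hU _ _
    _ = ∑ y, ‖(F ⊗ₖ G) x y‖ ^ 2 := by
        rw [Finset.sum_mul_sum, Fintype.sum_prod_type (α₁ := Fin K × Fin s)]
        simp only [kroneckerMap_apply, norm_mul, mul_pow]

/-- Separable matrices overlap with the subspace of the twisted key by at most the fraction
`1 / K`; the factor is hidden in the normalization of `keyBlock`. -/
lemma trace_keyBlock_re_le (hU : ∀ i j, U i j ∈ unitaryGroup (Fin s × Fin s) ℂ)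
    {σ : Matrix ((Fin K × Fin s) × (Fin K × Fin s)) ((Fin K × Fin s) × (Fin K × Fin s)) ℂ}
    (hσ : σ ∈ sepCone (Fin K × Fin s) (Fin K × Fin s)) :
    ((keyBlock U)ᴴ * σ * keyBlock U).trace.re ≤ σ.trace.re := by
  have h := map_mem_of_mem_sepCone
    (M := ℝ)
    { toFun := fun X : Matrix ((Fin K × Fin s) × (Fin K × Fin s))
          ((Fin K × Fin s) × (Fin K × Fin s)) ℂ =>
        X.trace.re - ((keyBlock U)ᴴ * X * keyBlock U).trace.re
      map_zero' := by simp
      map_add' := fun X Y => by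
        simp only [Matrix.mul_add, Matrix.add_mul, trace_add, Complex.add_re]
        ring } (AddSubmonoid.nonneg ℝ)
    (fun α β hα hβ => sub_nonneg.mpr (trace_keyBlock_kronecker_re_le hU hα hβ)) hσ
  exact sub_nonneg.mp h

/-- Distance of a dominated state to a private state: testing with the projection onto the range of
the key block gives one on the private state and at most `c / K` on the other one. -/
lemma IsPrivateState.le_half_traceNorm (hK : 0 < K)
    {γ φ : Matrix ((Fin K × Fin s) × (Fin K × Fin s)) ((Fin K × Fin s) × (Fin K × Fin s)) ℂ}
    (hγ : IsPrivateState γ) (hφ : IsState φ) {c : ℝ} (hc : IsDominated c φ) :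
    1 - c / K ≤ 1 / 2 * traceNorm (φ - γ) ∧ 1 / 2 * traceNorm (φ - γ) ≤ 1 := by
  obtain ⟨σ, U, hσ, hU, rfl⟩ := hγ
  rw [twisted_maxEntangled_eq]
  set W := keyBlock U with hW
  have hK0 : (K : ℂ) ≠ 0 := by exact_mod_cast hK.ne'
  have hWW : Wᴴ * W = (K : ℂ) • 1 := conjTranspose_keyBlock_mul_self hU
  set γ := (K : ℂ)⁻¹ • (W * σ * Wᴴ) with hγ
  have hγpos : γ.PosSemidef := by
    refine (hσ.posSemidef.mul_mul_conjTranspose_same W).smul ?_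
    rw [Complex.nonneg_iff]
    constructor <;> simp
  have hγtr : γ.trace = 1 := by
    rw [hγ, trace_smul, trace_mul_comm, ← Matrix.mul_assoc, hWW]
    simp [hσ.trace_eq_one, hK0]
  -- The projection onto the range of the key block.
  set P := (K : ℂ)⁻¹ • (W * Wᴴ) with hP
  have hPH : Pᴴ = P := by
    simp [hP, conjTranspose_smul]
  have hPP : P * P = P := by
    have : W * Wᴴ * (W * Wᴴ) = (K : ℂ) • (W * Wᴴ) := by
      rw [Matrix.mul_assoc, ← Matrix.mul_assoc Wᴴ, hWW]
      simp
    rw [hP, Matrix.smul_mul, Matrix.mul_smul, this, smul_smul, smul_smul, mul_assoc,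
      inv_mul_cancel₀ hK0, mul_one]
  have hPtr : ∀ X, (P * X).trace = (K : ℂ)⁻¹ * (Wᴴ * X * W).trace := by
    intro X
    rw [hP, Matrix.smul_mul, trace_smul, smul_eq_mul, Matrix.mul_assoc, trace_mul_comm]
  have hPγ : (P * γ).trace = 1 := by
    have : Wᴴ * (W * σ * Wᴴ) * W = ((K : ℂ) * K) • σ := by
      rw [Matrix.mul_assoc W, ← Matrix.mul_assoc Wᴴ W, hWW, Matrix.mul_assoc _ (σ * Wᴴ),
        Matrix.mul_assoc σ, hWW]
      simp [smul_smul]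
    rw [hPtr, hγ, Matrix.mul_smul, Matrix.smul_mul, this, smul_smul, trace_smul, hσ.trace_eq_one]
    field_simp
    simp
  have hPφ : (P * φ).trace.re ≤ c / K := by
    obtain ⟨τ, hτ, hle, htr⟩ := hc
    have h1 := (hle.conjTranspose_mul_mul_same W).trace_re_nonneg
    rw [Matrix.mul_sub, Matrix.sub_mul, trace_sub, Complex.sub_re] at h1
    have h2 := trace_keyBlock_re_le hU hτ
    have h3 : (P * φ).trace.re = (Wᴴ * φ * W).trace.re / K := by
      rw [hPtr, ← Complex.ofReal_natCast, ← Complex.ofReal_inv, Complex.re_ofReal_mul]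
      ring
    rw [h3]
    gcongr
    linarith
  constructor
  -- The trace norm is tested with the reflection `1 - 2 P`, which is unitary.
  · have hQ : (1 - (2 : ℂ) • P)ᴴ * (1 - (2 : ℂ) • P) = 1 := by
      have : (1 - (2 : ℂ) • P)ᴴ = 1 - (2 : ℂ) • P := by
        simp [conjTranspose_smul, hPH]
      rw [this]
      simp only [Matrix.sub_mul, Matrix.mul_sub, Matrix.one_mul, Matrix.mul_one, Matrix.smul_mul,
        Matrix.mul_smul, hPP]
      module
    have h := trace_mul_re_le_traceNorm
      (hφ.posSemidef.isHermitian.sub hγpos.isHermitian) hQ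
    have h' : ((1 - (2 : ℂ) • P) * (φ - γ)).trace = 2 - 2 * (P * φ).trace := by
      rw [Matrix.sub_mul, Matrix.one_mul, Matrix.smul_mul, Matrix.mul_sub, trace_sub, trace_smul,
        trace_sub, trace_sub, hφ.trace_eq_one, hγtr, hPγ, smul_eq_mul]
      ring
    rw [h'] at h
    simp only [Complex.sub_re, Complex.mul_re, Complex.re_ofNat, Complex.im_ofNat, zero_mul,
      sub_zero] at h
    linarith
  · have h := traceNorm_sub_le hφ.posSemidef hγpos
    rw [hφ.trace_eq_one, hγtr, Complex.one_re] at h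
    linarith

end PrivateState

/-! ### Finiteness of the max-relative entropy of entanglement of a channel -/

section Finiteness

variable {a b : ℕ} {T : Matrix (Fin a) (Fin a) ℂ →ₗ[ℂ] Matrix (Fin b) (Fin b) ℂ}

lemma IsDominated.eMaxState_le {A B : Type*} [Fintype A] [Fintype B]
    {ρ : Matrix (A × B) (A × B) ℂ} {c : ℝ} (hc : IsDominated c ρ) (hρ : IsState ρ) :
    eMaxState ρ ≤ ENNReal.ofReal (Real.logb 2 c) := by
  obtain ⟨τ, hτ, hle, htr⟩ := hc
  have h1 : 1 ≤ τ.trace.re := by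
    have := hle.trace_re_nonneg
    rw [trace_sub, hρ.trace_eq_one, Complex.sub_re, Complex.one_re] at this
    linarith
  rcases eq_zero_or_exists_isSeparable hτ with rfl | ⟨t, σ, ht, hσ, rfl⟩
  · norm_num at h1
  rw [trace_smul, hσ.trace_eq_one, Complex.smul_re, Complex.one_re, smul_eq_mul, mul_one]
    at h1 htr
  have hlog : 0 ≤ Real.logb 2 t := Real.logb_nonneg one_lt_two h1
  refine (iInf₂_le σ hσ).trans ((iInf₂_le (Real.logb 2 t).toNNReal ?_).trans ?_)
  · rwa [Real.coe_toNNReal _ hlog, Real.rpow_logb two_pos (by norm_num) ht]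
  · exact ENNReal.ofReal_le_ofReal (Real.logb_le_logb_of_le one_lt_two ht htr)

/-- The Choi matrix is bounded by a multiple of the identity, which belongs to a constant map. -/
lemma IsChannel.exists_isEntBreakingBound (hT : IsChannel T) :
    ∃ c S, IsEntBreakingBound T c S := by
  set κ := (choi T).trace.re
  have hκ : 0 ≤ κ := hT.posSemidef_choi.trace_re_nonneg
  refine ⟨κ * b, κ • 1, smul_mem_sepCone hκ ?_, ?_, ?_⟩
  · rw [← one_kronecker_one]
    exact kronecker_mem_sepCone .one .one
  · exact posSemidef_trace_smul_one_sub hT.posSemidef_choi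
  · convert PosSemidef.zero using 1
    rw [sub_eq_zero]
    ext s t
    by_cases h : s = t <;> simp [traceSnd, one_apply, h, mul_comm]

lemma IsChannel.eMax_lt_top (hT : IsChannel T) : eMax T < ∞ := by
  obtain ⟨c, S, hS⟩ := hT.exists_isEntBreakingBound
  refine lt_of_le_of_lt (iSup_le fun d => iSup₂_le fun ρ hρ => ?_)
    (ENNReal.ofReal_lt_top (r := Real.logb 2 c))
  have hst : IsState (applySnd T ρ) := by
    refine ⟨hT.completelyPositive d ρ hρ.posSemidef, ?_⟩
    rw [← hρ.trace_eq_one]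
    simp only [trace, Fintype.sum_prod_type]
    exact Finset.sum_congr rfl fun u _ =>
      hT.tracePreserving (of fun s t => ρ (u, s) (u, t))
  refine IsDominated.eMaxState_le ⟨link ρ S, link_mem_sepCone hρ.posSemidef hS.mem_sepCone, ?_, ?_⟩
    hst
  · rw [applySnd_eq_link, ← link_sub_right]
    exact posSemidef_link hρ.posSemidef hS.dominates
  · simpa [hρ.trace_eq_one] using trace_link_re_le hρ.posSemidef hS.traceSnd_le

end Finiteness

/-! ### A single entanglement breaking bound for all inputs -/

section Minimax

variable {a b : ℕ} {T : Matrix (Fin a) (Fin a) ℂ →ₗ[ℂ] Matrix (Fin b) (Fin b) ℂ}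

lemma trace_mul_traceSnd {n m : Type*} [Fintype n] [Fintype m] [DecidableEq m] (N : Matrix n n ℂ)
    (S : Matrix (n × m) (n × m) ℂ) :
    (N * traceSnd S).trace = ((N ⊗ₖ (1 : Matrix m m ℂ)) * S).trace := by
  simp only [trace, diag_apply, mul_apply, traceSnd, of_apply, Fintype.sum_prod_type,
    kroneckerMap_apply, one_apply, mul_ite, mul_one, mul_zero, ite_mul, zero_mul,
    Finset.sum_ite_eq, Finset.mem_univ, if_true, Finset.mul_sum]
  exact Finset.sum_congr rfl fun i _ => Finset.sum_comm

/-- Applying a map to the pure state with coefficient matrix `M` conjugates its Choi matrix by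
`M ⊗ 1`. -/
lemma link_vecMulVec {n m : Type*} [Fintype n] [Fintype m] [DecidableEq m] (M : Matrix n n ℂ)
    (J : Matrix (n × m) (n × m) ℂ) :
    link (vecMulVec (fun x : n × n => M x.1 x.2) (star fun x : n × n => M x.1 x.2)) J
      = (M ⊗ₖ (1 : Matrix m m ℂ)) * J * (M ⊗ₖ (1 : Matrix m m ℂ))ᴴ := by
  ext x y
  simp only [link, vecMulVec_apply, of_apply, mul_apply, conjTranspose_apply, kroneckerMap_apply,
    Fintype.sum_prod_type, one_apply, mul_ite, mul_one, mul_zero, ite_mul, zero_mul,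
    Finset.sum_ite_eq, Finset.mem_univ, if_true, Pi.star_apply, apply_ite star, star_zero,
    Finset.sum_mul]
  rw [Finset.sum_comm]
  exact Finset.sum_congr rfl fun s _ => Finset.sum_congr rfl fun t _ => by ring

/-- Evaluating the max-relative entropy of entanglement on a purification of the input `τ` gives
a separable bound on the Choi matrix which is good on the input `τ`. -/
lemma exists_separable_bound_of_posDef {l : ℝ≥0} (hl : eMax T < l)
    {τ : Matrix (Fin a) (Fin a) ℂ} (hτ : τ.PosDef) :
    ∃ S ∈ sepCone (Fin a) (Fin b), (S - choi T).PosSemidef ∧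
      (τ * traceSnd S).trace.re ≤ 2 ^ (l : ℝ) * τ.trace.re := by
  rcases isEmpty_or_nonempty (Fin a) with ha | ha
  · exact ⟨0, zero_mem _, by
      rw [Subsingleton.elim (0 - choi T) 0]
      exact .zero, by simp [trace]⟩
  set t := τ.trace.re with ht
  have htpos : 0 < t := (Complex.pos_iff.mp hτ.trace_pos).1
  obtain ⟨M, hM⟩ := exists_eq_conjTranspose_mul_self hτ.posSemidef
  have hMunit : IsUnit M.det := by
    have h := (isUnit_iff_isUnit_det _).mp hτ.isUnit
    rw [hM, det_mul] at h
    exact isUnit_of_mul_isUnit_right h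
  set ψ : Matrix (Fin a × Fin a) (Fin a × Fin a) ℂ :=
    vecMulVec (fun x => M x.1 x.2) (star fun x => M x.1 x.2) with hψ
  have hρ : IsState (t⁻¹ • ψ) := by
    refine ⟨(posSemidef_vecMulVec_self_star _).smul (inv_nonneg.mpr htpos.le), ?_⟩
    have : ψ.trace = τ.trace := by
      rw [hM, trace_mul_comm]
      simp [hψ, trace, mul_apply, vecMulVec_apply, Fintype.sum_prod_type]
    rw [trace_smul, this, hτ.posSemidef.trace_eq_ofReal, ← ht, Complex.real_smul,
      ← Complex.ofReal_mul, inv_mul_cancel₀ htpos.ne', Complex.ofReal_one]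
  have hlt : eMaxState (applySnd T (t⁻¹ • ψ)) < l :=
    ((le_iSup₂ (f := fun (ρ : Matrix (Fin a × Fin a) (Fin a × Fin a) ℂ) (_ : IsState ρ) =>
      eMaxState (applySnd T ρ)) _ hρ).trans (le_iSup (fun d => ⨆ (ρ : Matrix (Fin d × Fin a)
        (Fin d × Fin a) ℂ) (_ : IsState ρ), eMaxState (applySnd T ρ)) a)).trans_lt hl
  obtain ⟨σ, hσ, hlt⟩ := by simpa only [eMaxState, iInf_lt_iff, exists_prop] using hlt
  obtain ⟨l', hle, hlt⟩ := by simpa only [dMax, iInf_lt_iff, exists_prop] using hlt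
  set V := M ⊗ₖ (1 : Matrix (Fin b) (Fin b) ℂ) with hV
  set V' := M⁻¹ ⊗ₖ (1 : Matrix (Fin b) (Fin b) ℂ) with hV'
  have hV'V : V' * V = 1 := by
    rw [hV, hV', ← mul_kronecker_mul, nonsing_inv_mul _ hMunit, Matrix.one_mul, one_kronecker_one]
  have hVV' : V * V' = 1 := by
    rw [hV, hV', ← mul_kronecker_mul, mul_nonsing_inv _ hMunit, Matrix.one_mul, one_kronecker_one]
  set S := (t * 2 ^ (l' : ℝ)) • (V' * σ * V'ᴴ) with hS
  refine ⟨S, smul_mem_sepCone (by positivity) (conj_kronecker_mem_sepCone hσ.mem_sepCone _ _),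
    ?_, ?_⟩
  · have hT : applySnd T (t⁻¹ • ψ) = t⁻¹ • (V * choi T * Vᴴ) := by
      rw [applySnd_eq_link, ← link_vecMulVec]
      ext
      simp [link, Finset.mul_sum, mul_assoc, hψ]
    have h : S - choi T = t • (V' * ((2 : ℝ) ^ (l' : ℝ) • σ - applySnd T (t⁻¹ • ψ)) * V'ᴴ) := by
      have h1 : V' * (V * choi T * Vᴴ) * V'ᴴ = choi T := by
        have : Vᴴ * V'ᴴ = 1 := by rw [← conjTranspose_mul, hV'V, conjTranspose_one]
        rw [Matrix.mul_assoc V, ← Matrix.mul_assoc V', hV'V, Matrix.one_mul, Matrix.mul_assoc,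
          this, Matrix.mul_one]
      rw [hT, Matrix.mul_sub, Matrix.sub_mul, Matrix.mul_smul, Matrix.mul_smul, Matrix.smul_mul,
        Matrix.smul_mul, h1, smul_sub, smul_smul, smul_smul, mul_inv_cancel₀ htpos.ne', one_smul]
    rw [h]
    exact (hle.mul_mul_conjTranspose_same _).smul htpos.le
  · have h : (τ * traceSnd S).trace = ((t * 2 ^ (l' : ℝ) : ℝ) : ℂ) := by
      rw [trace_mul_traceSnd, hS, Matrix.mul_smul, trace_smul, hM]
      have : (Mᴴ * M) ⊗ₖ (1 : Matrix (Fin b) (Fin b) ℂ) = Vᴴ * V := by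
        rw [hV, conjTranspose_kronecker, ← mul_kronecker_mul]
        simp
      rw [this, ← Matrix.mul_assoc, ← Matrix.mul_assoc, Matrix.mul_assoc Vᴴ, hVV', Matrix.mul_one,
        trace_mul_comm, ← Matrix.mul_assoc, ← conjTranspose_mul, hVV', conjTranspose_one,
        Matrix.one_mul, hσ.trace_eq_one, Complex.real_smul, mul_one]
    rw [h, Complex.ofReal_re, mul_comm]
    gcongr
    · exact one_le_two
    · exact_mod_cast hlt.le

lemma isOpen_setOf_re_dotProduct_pos {n : Type*} [Fintype n] :
    IsOpen {X : Matrix n n ℂ | ∀ v : n → ℂ, v ≠ 0 → 0 < (star v ⬝ᵥ (X *ᵥ v)).re} := by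
  have heq : {X : Matrix n n ℂ | ∀ v : n → ℂ, v ≠ 0 → 0 < (star v ⬝ᵥ (X *ᵥ v)).re}
      = {X | ∀ v ∈ Metric.sphere (0 : n → ℂ) 1, 0 < (star v ⬝ᵥ (X *ᵥ v)).re} := by
    ext X
    refine ⟨fun h v hv => h v (Metric.ne_of_mem_sphere hv one_ne_zero), fun h v hv => ?_⟩
    have hn : 0 < ‖v‖ := norm_pos_iff.mpr hv
    have h1 := h (‖v‖⁻¹ • v) (by simp [norm_smul, hn.ne'])
    have h2 : (star (‖v‖⁻¹ • v) ⬝ᵥ (X *ᵥ (‖v‖⁻¹ • v))).re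
        = ‖v‖⁻¹ * (‖v‖⁻¹ * (star v ⬝ᵥ (X *ᵥ v)).re) := by
      rw [star_smul, smul_dotProduct, mulVec_smul, dotProduct_smul, Complex.smul_re,
        Complex.smul_re]
      simp
    rw [h2] at h1
    exact pos_of_mul_pos_right (pos_of_mul_pos_right h1 (by positivity)) (by positivity)
  rw [heq, isOpen_iff_eventually]
  intro X hX
  refine (isCompact_sphere (0 : n → ℂ) 1).eventually_forall_of_forall_eventually fun v hv => ?_
  have hcont : Continuous fun z : Matrix n n ℂ × (n → ℂ) => (star z.2 ⬝ᵥ (z.1 *ᵥ z.2)).re := by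
    fun_prop
  exact hcont.continuousAt.eventually (lt_mem_nhds (hX v hv))

/-- Real linear functionals on Hermitian matrices are given by Hermitian matrices through the trace
pairing. -/
lemma exists_isHermitian_trace_mul_eq {n : Type*} [Fintype n] [DecidableEq n]
    (f : Matrix n n ℂ →ₗ[ℝ] ℝ) :
    ∃ τ : Matrix n n ℂ, τ.IsHermitian ∧ ∀ X : Matrix n n ℂ, X.IsHermitian →
      f X = (τ * X).trace.re := by
  set N : Matrix n n ℂ := of fun t s =>
    (f (single s t 1) : ℂ) - Complex.I * f (single s t Complex.I) with hN
  have hf : ∀ X, f X = (N * X).trace.re := by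
    intro X
    have hX : X = ∑ s, ∑ t, ((X s t).re • single s t (1 : ℂ)
        + (X s t).im • single s t Complex.I) := by
      conv_lhs => rw [matrix_eq_sum_single X]
      refine Finset.sum_congr rfl fun s _ => Finset.sum_congr rfl fun t _ => ?_
      rw [smul_single, smul_single, ← single_add]
      congr 1
      simp [Complex.re_add_im]
    conv_lhs => rw [hX]
    simp only [map_sum, map_add, map_smul, smul_eq_mul, trace, diag_apply, mul_apply,
      Complex.re_sum, hN, of_apply]
    rw [Finset.sum_comm]
    refine Finset.sum_congr rfl fun t _ => Finset.sum_congr rfl fun s _ => ?_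
    simp [Complex.mul_re]
    ring
  refine ⟨(1 / 2 : ℝ) • (N + Nᴴ), ?_, fun X hX => ?_⟩
  · simp [IsHermitian, conjTranspose_smul, add_comm]
  · have h : (Nᴴ * X).trace.re = (N * X).trace.re := by
      have : (Nᴴ * X).trace = star (N * X).trace := by
        rw [← trace_conjTranspose, conjTranspose_mul, hX.eq, trace_mul_comm]
      rw [this]
      simp
    rw [smul_mul, Matrix.add_mul, trace_smul, trace_add, Complex.smul_re, Complex.add_re, h, hf X,
      smul_eq_mul]
    ring

lemma isHermitian_traceSnd {n m : Type*} [Fintype m] {S : Matrix (n × m) (n × m) ℂ}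
    (hS : S.IsHermitian) : (traceSnd S).IsHermitian := by
  ext s t
  simp only [traceSnd, conjTranspose_apply, of_apply, star_sum]
  exact Finset.sum_congr rfl fun x _ => hS.apply _ _

lemma traceSnd_add {n m : Type*} [Fintype m] (S S' : Matrix (n × m) (n × m) ℂ) :
    traceSnd (S + S') = traceSnd S + traceSnd S' := by
  ext
  simp [traceSnd, Finset.sum_add_distrib]

lemma traceSnd_smul {n m : Type*} [Fintype m] (c : ℝ) (S : Matrix (n × m) (n × m) ℂ) :
    traceSnd (c • S) = c • traceSnd S := by
  ext
  simp [traceSnd, Finset.mul_sum]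

/-- Minimax: the separable bounds for the individual inputs, provided by
`exists_separable_bound_of_posDef`, can be replaced by a single one. Otherwise a hyperplane
separates `c • 1` from the convex set of strict upper bounds of the partial traces of the separable
bounds, and its normal vector is an input `τ` on which no separable bound is good. -/
lemma exists_isEntBreakingBound_of_eMax_lt (hT : IsChannel T) {l : ℝ≥0} (hl : eMax T < l) {c : ℝ}
    (hc : 2 ^ (l : ℝ) < c) : ∃ S, IsEntBreakingBound T c S := by
  by_contra! hno
  set P : Set (Matrix (Fin a) (Fin a) ℂ) :=
    {X | ∀ v : Fin a → ℂ, v ≠ 0 → 0 < (star v ⬝ᵥ (X *ᵥ v)).re} with hP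
  have hPone : ∀ δ : ℝ, 0 < δ → δ • (1 : Matrix (Fin a) (Fin a) ℂ) ∈ P := by
    intro δ hδ v hv
    rw [smul_mulVec, one_mulVec, dotProduct_smul, Complex.smul_re, smul_eq_mul]
    exact mul_pos hδ (Complex.pos_iff.mp (dotProduct_star_self_pos_iff.mpr hv)).1
  have hPadd : ∀ X ∈ P, ∀ Y : Matrix (Fin a) (Fin a) ℂ, Y.PosSemidef → X + Y ∈ P := by
    intro X hX Y hY v hv
    rw [add_mulVec, dotProduct_add, Complex.add_re]
    exact add_pos_of_pos_of_nonneg (hX v hv) (hY.re_dotProduct_nonneg v)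
  set K : Set (Matrix (Fin a × Fin b) (Fin a × Fin b) ℂ) :=
    {S | S ∈ sepCone (Fin a) (Fin b) ∧ (S - choi T).PosSemidef} with hK
  have hKherm : ∀ S ∈ K, S.IsHermitian := fun S hS => (posSemidef_of_mem_sepCone hS.1).isHermitian
  set G : Set (Matrix (Fin a) (Fin a) ℂ) := ⋃ S ∈ K, (fun X => X - traceSnd S) ⁻¹' P with hG
  have hGmem : ∀ S ∈ K, ∀ Y ∈ P, traceSnd S + Y ∈ G := by
    intro S hS Y hY
    simp only [hG, Set.mem_iUnion, Set.mem_preimage]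
    exact ⟨S, hS, by simpa using hY⟩
  have hGopen : IsOpen G := isOpen_biUnion fun S _ =>
    isOpen_setOf_re_dotProduct_pos.preimage (by fun_prop)
  have hGconv : Convex ℝ G := by
    intro X hX Y hY s t hs ht hst
    simp only [hG, Set.mem_iUnion, Set.mem_preimage] at hX hY ⊢
    obtain ⟨S, hS, hX⟩ := hX
    obtain ⟨S', hS', hY⟩ := hY
    refine ⟨s • S + t • S', ⟨add_mem (smul_mem_sepCone hs hS.1) (smul_mem_sepCone ht hS'.1), ?_⟩,
      fun v hv => ?_⟩
    · have : s • S + t • S' - choi T = s • (S - choi T) + t • (S' - choi T) := by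
        rw [smul_sub, smul_sub, sub_add_sub_comm, ← add_smul, hst, one_smul]
      rw [this]
      exact (hS.2.smul hs).add (hS'.2.smul ht)
    · have : s • X + t • Y - traceSnd (s • S + t • S')
          = s • (X - traceSnd S) + t • (Y - traceSnd S') := by
        rw [traceSnd_add, traceSnd_smul, traceSnd_smul, smul_sub, smul_sub, sub_add_sub_comm]
      rw [this, add_mulVec, dotProduct_add, smul_mulVec, smul_mulVec, dotProduct_smul,
        dotProduct_smul, Complex.add_re, Complex.smul_re, Complex.smul_re]
      exact convex_Ioi (0 : ℝ) (hX v hv) (hY v hv) hs ht hst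
  have hcG : c • (1 : Matrix (Fin a) (Fin a) ℂ) ∉ G := by
    intro h
    simp only [hG, Set.mem_iUnion, Set.mem_preimage] at h
    obtain ⟨S, hS, h⟩ := h
    refine hno S ⟨hS.1, hS.2, (posSemidef_iff_re ?_).mpr fun v => ?_⟩
    · refine IsHermitian.sub ?_ (isHermitian_traceSnd (hKherm S hS))
      simp [IsHermitian, conjTranspose_smul]
    · rcases eq_or_ne v 0 with rfl | hv
      · simp
      · exact (h v hv).le
  obtain ⟨f, hf⟩ := geometric_hahn_banach_point_open hGconv hGopen hcG
  obtain ⟨τ, hτherm, hτ⟩ := exists_isHermitian_trace_mul_eq (f : Matrix (Fin a) (Fin a) ℂ →ₗ[ℝ] ℝ)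
  simp only [ContinuousLinearMap.coe_coe] at hτ
  obtain ⟨c₀, S₀, hS₀⟩ := hT.exists_isEntBreakingBound
  have hS₀K : S₀ ∈ K := ⟨hS₀.mem_sepCone, hS₀.dominates⟩
  have hfnonneg : ∀ Y : Matrix (Fin a) (Fin a) ℂ, Y.PosSemidef → 0 ≤ f Y := by
    intro Y hY
    by_contra! hneg
    set x₀ := f (traceSnd S₀ + (1 : ℝ) • 1) with hx₀
    have hx : f (c • 1) < x₀ := hf _ (hGmem S₀ hS₀K _ (hPone 1 one_pos))
    obtain ⟨w, hw0, hw⟩ : ∃ w, 0 ≤ w ∧ w * f Y = f (c • 1) - x₀ :=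
      ⟨_, div_nonneg_of_nonpos (sub_nonpos.mpr hx.le) hneg.le, div_mul_cancel₀ _ hneg.ne⟩
    have h := hf _ (hGmem S₀ hS₀K _ (hPadd _ (hPone 1 one_pos) _ (hY.smul hw0)))
    rw [← add_assoc, map_add, ← hx₀, map_smul f w Y, smul_eq_mul, hw] at h
    linarith
  have hτpos : τ.PosSemidef := by
    refine (posSemidef_iff_re hτherm).mpr fun v => ?_
    have h := hfnonneg _ (posSemidef_vecMulVec_self_star v)
    rw [hτ _ (posSemidef_vecMulVec_self_star v).isHermitian, mul_vecMulVec, trace_vecMulVec,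
      dotProduct_comm] at h
    exact h
  have hone : f 1 = τ.trace.re := by rw [hτ 1 isHermitian_one, Matrix.mul_one]
  have htr : 0 < τ.trace.re := by
    refine hτpos.trace_re_nonneg.lt_of_ne fun h0 => ?_
    have hτ0 : τ = 0 := by
      rw [← hτpos.trace_eq_zero_iff, hτpos.trace_eq_ofReal, ← h0, Complex.ofReal_zero]
    have h := hf _ (hGmem S₀ hS₀K _ (hPone 1 one_pos))
    rw [map_add, hτ _ (isHermitian_traceSnd (hKherm _ hS₀K)), map_smul, map_smul, hone, hτ0] at h
    simp at h
  have key : ∀ ε : ℝ, 0 < ε → ∀ δ : ℝ, 0 < δ →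
      c * τ.trace.re < 2 ^ (l : ℝ) * (τ.trace.re + ε * a) + δ * τ.trace.re := by
    intro ε hε δ hδ
    -- The normal vector `τ` may be singular, so it is perturbed to a positive definite matrix.
    have hτε : (τ + ε • (1 : Matrix (Fin a) (Fin a) ℂ)).PosDef :=
      PosDef.posSemidef_add hτpos (PosDef.one.smul hε)
    obtain ⟨S, hS, hdom, hle⟩ := exists_separable_bound_of_posDef hl hτε
    have h := hf _ (hGmem S ⟨hS, hdom⟩ _ (hPone δ hδ))
    rw [map_add, hτ _ (isHermitian_traceSnd (hKherm _ ⟨hS, hdom⟩)), map_smul, map_smul, hone,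
      smul_eq_mul, smul_eq_mul] at h
    have h1 : 0 ≤ (traceSnd S).trace.re := by
      have : (traceSnd S).trace = S.trace := by
        simp [trace, traceSnd, Fintype.sum_prod_type]
      rw [this]
      exact (posSemidef_of_mem_sepCone hS).trace_re_nonneg
    rw [Matrix.add_mul, smul_mul, Matrix.one_mul, trace_add, trace_add, trace_smul, trace_smul,
      Complex.add_re, Complex.add_re, Complex.smul_re, Complex.smul_re, trace_one,
      Fintype.card_fin, Complex.natCast_re, smul_eq_mul, smul_eq_mul] at hle
    nlinarith [mul_nonneg hε.le h1]
  set d := c - 2 ^ (l : ℝ) with hd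
  have hdpos : 0 < d := sub_pos.mpr hc
  have h2 : (0 : ℝ) < 2 ^ (l : ℝ) := by positivity
  have h := key (d * τ.trace.re / (4 * (2 ^ (l : ℝ) * a + 1))) (by positivity) (d / 4)
    (by positivity)
  have h3 : 2 ^ (l : ℝ) * (d * τ.trace.re / (4 * (2 ^ (l : ℝ) * a + 1)) * a)
      ≤ d * τ.trace.re / 4 := by
    rw [show 2 ^ (l : ℝ) * (d * τ.trace.re / (4 * (2 ^ (l : ℝ) * a + 1)) * a)
      = d * τ.trace.re / 4 * ((2 ^ (l : ℝ) * a) / (2 ^ (l : ℝ) * a + 1)) by field_simp]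
    refine mul_le_of_le_one_right (by positivity) ?_
    rw [div_le_one (by positivity)]
    linarith
  have h4 : 0 < d * τ.trace.re := mul_pos hdpos htr
  have h5 : c * τ.trace.re = d * τ.trace.re + 2 ^ (l : ℝ) * τ.trace.re := by
    rw [hd]
    ring
  rw [h5, mul_add] at h
  linarith

end Minimax

/-! ### The strong converse -/

section StrongConverse

variable {a b : ℕ} {T : Matrix (Fin a) (Fin a) ℂ →ₗ[ℂ] Matrix (Fin b) (Fin b) ℂ}

/-- The lower bound on the error tends to one, exponentially in `m`, at rates above `log₂ c`. -/
lemma HasPrivateScheme.error_bounds (hT : IsChannel T) {c : ℝ} (hc : 0 ≤ c)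
    {S : Matrix (Fin a × Fin b) (Fin a × Fin b) ℂ} (hS : IsEntBreakingBound T c S)
    {k m : ℕ} {ε : ℝ} (h : HasPrivateScheme T k m ε) : 1 - c ^ m / 2 ^ k ≤ ε ∧ ε ≤ 1 := by
  obtain ⟨s, φ, γ, hφ, hγ, rfl⟩ := h
  obtain ⟨h1, h2⟩ := hφ.isState_and_isDominated hT hc hS
  simpa only [Nat.cast_pow, Nat.cast_ofNat] using
    hγ.le_half_traceNorm (pow_pos two_pos k) h1 h2

lemma IsSchemeSequence.tendsto_one (hT : IsChannel T) {R : ℝ≥0} {k m : ℕ → ℕ} {ε : ℕ → ℝ}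
    (h : IsSchemeSequence T R k m ε) (hR : eMax T < R) : Tendsto ε atTop (𝓝 1) := by
  obtain ⟨r, hr, hrR⟩ := ENNReal.lt_iff_exists_nnreal_btwn.mp hR
  obtain ⟨l, hl, hlr⟩ := ENNReal.lt_iff_exists_nnreal_btwn.mp hr
  have hrR' : (r : ℝ) < R := by exact_mod_cast hrR
  have hlr' : (l : ℝ) < r := by exact_mod_cast hlr
  obtain ⟨S, hS⟩ := exists_isEntBreakingBound_of_eMax_lt hT hl
    (Real.rpow_lt_rpow_of_exponent_lt one_lt_two hlr')
  have hbounds := fun ν => (h.scheme ν).error_bounds hT (by positivity) hS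
  obtain ⟨q, hrq, hqR⟩ := exists_between hrR'
  have hlim : Tendsto (fun ν => 1 - ((2 : ℝ) ^ ((r : ℝ) - q)) ^ m ν) atTop (𝓝 1) := by
    have hlt : (2 : ℝ) ^ ((r : ℝ) - q) < 1 :=
      Real.rpow_lt_one_of_one_lt_of_neg one_lt_two (by linarith)
    simpa using
      ((tendsto_pow_atTop_nhds_zero_of_lt_one (by positivity) hlt).comp h.uses).const_sub 1
  refine tendsto_of_tendsto_of_tendsto_of_le_of_le' hlim tendsto_const_nhds ?_
    (Eventually.of_forall fun ν => (hbounds ν).2)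
  filter_upwards [h.rate.eventually (lt_mem_nhds hqR), h.uses.eventually_gt_atTop 0] with ν hν hm
  refine le_trans (sub_le_sub_left ?_ 1) (hbounds ν).1
  have hm' : (0 : ℝ) < m ν := by exact_mod_cast hm
  rw [lt_div_iff₀ hm'] at hν
  rw [div_le_iff₀ (by positivity), ← Real.rpow_mul_natCast two_pos.le,
    ← Real.rpow_mul_natCast two_pos.le, ← Real.rpow_natCast 2 (k ν), ← Real.rpow_add two_pos]
  exact Real.rpow_le_rpow_of_exponent_le one_le_two (by linarith)

end StrongConverse

end PrivateCapacity

theorem theorem5 {a b : ℕ} (T : Matrix (Fin a) (Fin a) ℂ →ₗ[ℂ] Matrix (Fin b) (Fin b) ℂ)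
    (hT : PrivateCapacity.IsChannel T) :
    PrivateCapacity.IsStrongConverseBound T (PrivateCapacity.eMax T) := by
  have hconv := fun R k m ε (h : PrivateCapacity.IsSchemeSequence T R k m ε)
    (hR : PrivateCapacity.eMax T < R) => h.tendsto_one hT hR
  refine ⟨hT.eMax_lt_top, iSup₂_le fun R hR => ?_, hconv⟩
  obtain ⟨k, m, ε, h, hε⟩ := hR
  by_contra! hlt
  exact zero_ne_one (tendsto_nhds_unique hε (hconv R k m ε h hlt))
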